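/- Let $X$ be a smooth complex variety, that is, either a smooth separated scheme of finite type over $\mathbb{C}$ with its Zariski topology and structure sheaf $\mathcal{O}_X$, or a complex manifold of dimension $n$ with its sheaf $\mathcal{O}_X$ of holomorphic functions. Put $\mathbb{C}^\hbar=\mathbb{C}[[\hbar]]$ and $\mathbb{C}^{\hbar,loc}=\mathbb{C}((\hbar))$. A star product on $\mathcal{O}_X[[\hbar]]$ is an associative $\mathbb{C}^\hbar$-bilinear multiplication $\star$ with $f\star g=\sum_{i\ge 0}P_i(f,g)\hbar^i$ for $f,g\in\mathcal{O}_X$, where the $P_i$ are bidifferential operators, $P_0(f,g)=fg$, and $P_i(f,1)=P_i(1,f)=0$ for $i>0$. A DQ-algebroid on $X$ is a $\mathbb{C}^\hbar$-linear stack $\mathcal{A}_X$ on $X$ which is locally non-empty, in which any two objects over an open set are locally isomorphic, and such that for every open $U\subset X$ and every $\sigma\in\mathcal{A}_X(U)$ the sheaf of $\mathbb{C}^\hbar$-algebras $\mathcal{E}nd(\sigma)$ on $U$ is locally isomorphic to an algebra $(\mathcal{O}_X[[\hbar]],\star)$ for some star product $\star$. Let $\mathcal{A}_X$ be a DQ-algebroid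 on $X$. Let $\mathrm{Mod}(\mathcal{A}_X)$ be the abelian category of $\mathbb{C}^\hbar$-linear functors of stacks from $\mathcal{A}_X$ to the stack $U\mapsto\mathrm{Mod}(\mathbb{C}^\hbar_U)$ of sheaves of $\mathbb{C}^\hbar$-modules, let $\mathsf{D}(\mathcal{A}_X)$ be its derived category, and let $\mathsf{D}^{-}(\mathcal{A}_X)\subset\mathsf{D}(\mathcal{A}_X)$ be the full subcategory of the objects whose cohomology vanishes in all sufficiently large degrees. Put $\mathcal{A}_X^{loc}=\mathbb{C}^{\hbar,loc}\otimes_{\mathbb{C}^\hbar}\mathcal{A}_X$, an $\mathcal{A}_X$-bimodule, and let $\mathrm{R}\mathcal{H}om_{\mathcal{A}_X}(\mathcal{A}_X^{loc},\cdot)$ be the right derived functor of $\mathcal{H}om_{\mathcal{A}_X}(\mathcal{A}_X^{loc},\cdot)\colon\mathrm{Mod}(\mathcal{A}_X)\to\mathrm{Mod}(\mathcal{A}_X)$, computed on $\mathsf{D}(\mathcal{A}_X)$ by K-injective resolutions. Then $$\mathrm{R}\mathcal{H}om_{\mathcal{A}_X}\bigl(\mathcal{A}_X^{loc},\mathsf{D}^{-}(\mathcal{A}_X)\bigr)\subset\mathsf{D}^{-}(\mathcal{A}_X).$$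 -/

import Mathlib

open CategoryTheory Opposite TopologicalSpace Limits AlgebraicGeometry
open scoped ZeroObject Manifold ContDiff PowerSeries LaurentSeries Bicategory DirectSum

universe w

noncomputable section

namespace DQ

/-- A topological space with a sheaf of commutative `ℂ`-algebras (the algebra structure is given by
the constant global sections). -/
structure CAlgSpace where
  space : TopCat.{0}
  sheaf : TopCat.Sheaf CommRingCat.{0} space
  const : ℂ →+* sheaf.presheaf.obj (op ⊤)

/-- A smooth complex variety: either a smooth, separated, quasi-compact scheme over `ℂ`
(with its Zariski topology), or a complex manifold of dimension `n`. -/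
inductive SmoothComplexVariety : Type 1
  | algebraic (S : Scheme.{0}) (f : S ⟶ Spec (CommRingCat.of ℂ))
      (smooth : Smooth f) (separated : IsSeparated f) (quasiCompact : QuasiCompact f)
  | analytic (n : ℕ) (M : Type) [TopologicalSpace M] [T2Space M]
      [ChartedSpace (EuclideanSpace ℂ (Fin n)) M]
      [IsManifold 𝓘(ℂ, EuclideanSpace ℂ (Fin n)) ∞ M]

/-- The underlying space with its structure sheaf `𝒪_X`: the structure sheaf of the scheme, or the
sheaf of holomorphic functions. -/
def SmoothComplexVariety.toCAlgSpace : SmoothComplexVariety → CAlgSpace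
  | algebraic S f _ _ _ =>
    { space := S.toTopCat
      sheaf := S.sheaf
      const := ((Scheme.ΓSpecIso (CommRingCat.of ℂ)).inv ≫ f.appTop).hom }
  | @analytic n M _ _ _ _ =>
    { space := TopCat.of M
      sheaf := smoothSheafCommRing 𝓘(ℂ, EuclideanSpace ℂ (Fin n)) 𝓘(ℂ) M ℂ
      const := algebraMap ℂ C^∞⟮𝓘(ℂ, EuclideanSpace ℂ (Fin n)), (⊤ : Opens M); 𝓘(ℂ), ℂ⟯ }

namespace CAlgSpace

variable (X : CAlgSpace)

/-- The sections of the structure sheaf over `U`. -/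
def Sec (U : Opens X.space) : Type := X.sheaf.presheaf.obj (op U)

instance (U : Opens X.space) : CommRing (X.Sec U) :=
  inferInstanceAs (CommRing (X.sheaf.presheaf.obj (op U)))

/-- Restriction of sections. -/
def res {U V : Opens X.space} (h : V ≤ U) : X.Sec U →+* X.Sec V :=
  (X.sheaf.presheaf.map (homOfLE h).op).hom

instance (U : Opens X.space) : Algebra ℂ (X.Sec U) :=
  ((X.res (le_top : U ≤ ⊤)).comp X.const).toAlgebra

end CAlgSpace

/-- `D` is a differential operator of order at most `k` (in the sense of Grothendieck). -/
def IsDiffOp {A : Type} [CommRing A] [Algebra ℂ A] : ℕ → (A →ₗ[ℂ] A) → Prop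
  | 0, D => ∀ a b : A, D (a * b) = a * D b
  | k + 1, D => ∀ a : A, IsDiffOp k (D ∘ₗ LinearMap.mulLeft ℂ a - LinearMap.mulLeft ℂ a ∘ₗ D)

/-- A sequence `P 0, P 1, …` of bidifferential operators on the structure sheaf over `V`:
`ℂ`-bilinear, compatible with restrictions, and locally of finite order in each argument. -/
structure BidiffSeq (X : CAlgSpace) (V : Opens X.space) where
  P : ℕ → ∀ W : Opens X.space, W ≤ V → (X.Sec W →ₗ[ℂ] X.Sec W →ₗ[ℂ] X.Sec W)
  res_P : ∀ (n : ℕ) (W W' : Opens X.space) (hW : W ≤ V) (h : W' ≤ W) (f g : X.Sec W),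
    X.res h (P n W hW f g) = P n W' (h.trans hW) (X.res h f) (X.res h g)
  locally_finite_order : ∀ (n : ℕ) (x : X.space), x ∈ V →
    ∃ (V' : Opens X.space) (hV' : V' ≤ V), x ∈ V' ∧ ∃ k : ℕ,
      ∀ (W : Opens X.space) (hW : W ≤ V') (f : X.Sec W),
        IsDiffOp k (P n W (hW.trans hV') f) ∧ IsDiffOp k ((P n W (hW.trans hV')).flip f)

/-- The `ℂ⟦ħ⟧`-bilinear product on `𝒪⟦ħ⟧` with `f ⋆ g = ∑ᵢ Pᵢ(f, g) ħⁱ` for `f, g ∈ 𝒪`. -/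
def BidiffSeq.mul {X : CAlgSpace} {V : Opens X.space} (B : BidiffSeq X V)
    {W : Opens X.space} (hW : W ≤ V) (f g : (X.Sec W)⟦X⟧) : (X.Sec W)⟦X⟧ :=
  PowerSeries.mk fun n => ∑ p ∈ Finset.HasAntidiagonal.antidiagonal n,
    ∑ q ∈ Finset.HasAntidiagonal.antidiagonal p.2,
      B.P p.1 W hW (PowerSeries.coeff q.1 f) (PowerSeries.coeff q.2 g)

/-- A star product on `𝒪⟦ħ⟧` over `V`. -/
structure StarProduct (X : CAlgSpace) (V : Opens X.space) extends BidiffSeq X V where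
  P_zero : ∀ (W : Opens X.space) (hW : W ≤ V) (f g : X.Sec W), P 0 W hW f g = f * g
  P_one : ∀ (n : ℕ) (W : Opens X.space) (hW : W ≤ V) (f : X.Sec W), 0 < n →
    P n W hW f 1 = 0 ∧ P n W hW 1 f = 0
  mul_assoc : ∀ (W : Opens X.space) (hW : W ≤ V) (f g h : (X.Sec W)⟦X⟧),
    toBidiffSeq.mul hW (toBidiffSeq.mul hW f g) h = toBidiffSeq.mul hW f (toBidiffSeq.mul hW g h)

/-- An `R`-algebroid stack on `X`: an `R`-linear stack which is locally non-empty and in which any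
two objects are locally isomorphic. -/
structure Algebroid (R : Type) [CommRing R] (X : TopCat.{0}) where
  F : LocallyDiscrete (Opens X)ᵒᵖ ⥤ᵖ Cat.{0, 0}
  isStack : F.IsStack (Opens.grothendieckTopology X)
  preadditive : ∀ U, Preadditive (F.obj U)
  linear : ∀ U, Linear R (F.obj U)
  map_additive : ∀ {U V} (f : U ⟶ V), (F.map f).toFunctor.Additive
  map_linear : ∀ {U V} (f : U ⟶ V), (F.map f).toFunctor.Linear R
  locally_nonempty : ∀ x : X, ∃ U : Opens X, x ∈ U ∧ Nonempty (F.obj (.mk (op U)))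
  locally_iso : ∀ (U : Opens X) (σ τ : F.obj (.mk (op U))) (x : X), x ∈ U →
    ∃ (V : Opens X) (i : V ⟶ U), x ∈ V ∧
      Nonempty ((F.map i.op.toLoc).toFunctor.obj σ ≅ (F.map i.op.toLoc).toFunctor.obj τ)

namespace Algebroid
attribute [instance] preadditive linear map_additive map_linear

variable {R : Type} [CommRing R] {X : TopCat.{0}} (A : Algebroid R X)

/-- The total category of the stack: objects are pairs `(U, σ)` with `σ ∈ 𝒜(U)`, and a morphism
`(U, σ) ⟶ (V, τ)` is an inclusion `V ⊆ U` together with a morphism `σ|_V ⟶ τ` in `𝒜(V)`. -/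
abbrev Total : Type := A.F.Grothendieck

/-- The opposite of the total category, on which modules over `𝒜` are contravariant. -/
abbrev Site : Type := A.Totalᵒᵖ

/-- The morphism `(U, σ) ⟶ (V, τ)` given by `i : V ⊆ U` and `a : σ|_V ⟶ τ`. -/
def homMk {c d : A.Total} (i : c.base ⟶ d.base)
    (a : (A.F.map i.toLoc).toFunctor.obj c.fiber ⟶ d.fiber) : c ⟶ d := ⟨i, a⟩

/-- The restriction `(V, σ|_V)` of `(U, σ)`. -/
def restrict (c : A.Total) {V : Opens X} (i : V ⟶ c.base.unop) : A.Total :=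
  ⟨op V, (A.F.map i.op.toLoc).toFunctor.obj c.fiber⟩

/-- The canonical morphism `(U, σ) ⟶ (V, σ|_V)`. -/
def toRestrict (c : A.Total) {V : Opens X} (i : V ⟶ c.base.unop) : c ⟶ A.restrict c i :=
  A.homMk (d := A.restrict c i) i.op (𝟙 _)

lemma exists_linear_fac {c e : A.Total} {V : Opens X} (i : V ⟶ c.base.unop)
    (j : e.base.unop ⟶ V) (b : c.base ⟶ e.base) :
    ∃ K : ((A.F.map b.toLoc).toFunctor.obj c.fiber ⟶ e.fiber) →ₗ[R]
        ((A.F.map j.op.toLoc).toFunctor.obj (A.restrict c i).fiber ⟶ e.fiber),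
      ∀ f, A.toRestrict c i ≫ A.homMk (c := A.restrict c i) j.op (K f) = A.homMk b f := by
  obtain rfl : b = i.op ≫ j.op := Subsingleton.elim _ _
  refine ⟨Linear.leftComp R _
    ((A.F.mapComp i.op.toLoc j.op.toLoc).inv.toNatTrans.app c.fiber), fun f => ?_⟩
  refine Pseudofunctor.Grothendieck.Hom.ext _ _ rfl ?_
  have h : (A.F.mapComp i.op.toLoc j.op.toLoc).hom.toNatTrans.app c.fiber ≫
      (A.F.mapComp i.op.toLoc j.op.toLoc).inv.toNatTrans.app c.fiber = 𝟙 _ := by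
    rw [← Cat.Hom₂.comp_app, Iso.hom_inv_id]; rfl
  change 𝟙 _ ≫ (A.F.mapComp i.op.toLoc j.op.toLoc).hom.toNatTrans.app c.fiber ≫
    (A.F.map j.op.toLoc).toFunctor.map (𝟙 ((A.F.map i.op.toLoc).toFunctor.obj c.fiber)) ≫
    (A.F.mapComp i.op.toLoc j.op.toLoc).inv.toNatTrans.app c.fiber ≫ f = f
  erw [CategoryTheory.Functor.map_id, Category.id_comp, Category.id_comp]
  exact (Category.assoc _ _ _).symm.trans ((congrArg (· ≫ f) h).trans (Category.id_comp f))

lemma exists_fac {c e : A.Total} {V : Opens X} (i : V ⟶ c.base.unop) (j : e.base.unop ⟶ V)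
    (g : c ⟶ e) : ∃ k : A.restrict c i ⟶ e, A.toRestrict c i ≫ k = g := by
  obtain ⟨K, hK⟩ := A.exists_linear_fac i j g.base
  exact ⟨_, hK g.fiber⟩

lemma exists_linear_comp {c d e : A.Total} (i : c.base ⟶ d.base) (g : d ⟶ e) :
    ∃ K : ((A.F.map i.toLoc).toFunctor.obj c.fiber ⟶ d.fiber) →ₗ[R]
        ((A.F.map (i ≫ g.base).toLoc).toFunctor.obj c.fiber ⟶ e.fiber),
      ∀ a, A.homMk i a ≫ g = A.homMk (i ≫ g.base) (K a) :=
  ⟨Linear.leftComp R _ ((A.F.mapComp i.toLoc g.base.toLoc).hom.toNatTrans.app c.fiber) ∘ₗ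
    Linear.rightComp R _ g.fiber ∘ₗ (A.F.map g.base.toLoc).toFunctor.mapLinearMap R,
    fun _ => rfl⟩

/-- A sieve on `(U, σ)` is covering if the open sets `V ⊆ U` whose restriction morphism
`(U, σ) ⟶ (V, σ|_V)` it contains cover `U`. -/
def topology : GrothendieckTopology A.Site where
  sieves c := {S | ∀ x ∈ c.unop.base.unop, ∃ (V : Opens X) (i : V ⟶ c.unop.base.unop),
    x ∈ V ∧ S.arrows (A.toRestrict c.unop i).op}
  top_mem' c x hx := ⟨_, 𝟙 _, hx, trivial⟩
  pullback_stable' c d S f hS x hx := by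
    obtain ⟨V, i, hxV, hV⟩ := hS x (leOfHom f.unop.base.unop hx)
    refine ⟨V ⊓ d.unop.base.unop, homOfLE inf_le_right, ⟨hxV, hx⟩, ?_⟩
    obtain ⟨k, hk⟩ := A.exists_fac i (homOfLE inf_le_left)
      (f.unop ≫ A.toRestrict d.unop (homOfLE (inf_le_right : V ⊓ d.unop.base.unop ≤ _)))
    have := S.downward_closed hV k.op
    rw [← op_comp, hk] at this
    exact this
  transitive' c S hS T hT x hx := by
    obtain ⟨V, i, hxV, hV⟩ := hS x hx
    obtain ⟨W, j, hxW, hW⟩ := hT hV x hxV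
    refine ⟨W, j ≫ i, hxW, ?_⟩
    obtain ⟨k, hk⟩ := A.exists_fac i j (A.toRestrict c.unop (j ≫ i))
    obtain ⟨l, hl⟩ := A.exists_fac j (𝟙 W) k
    have := T.downward_closed hW l.op
    have e : l.op ≫ (A.toRestrict (A.restrict c.unop i) j).op ≫ (A.toRestrict c.unop i).op
        = (A.toRestrict c.unop (j ≫ i)).op := by
      rw [← op_comp, ← op_comp, Category.assoc, hl, hk]
    rwa [← e]

/-- `N` is `R`-linear on the morphisms lying over a fixed inclusion of open sets. -/
structure IsLinear (N : A.Siteᵒᵖ ⥤ ModuleCat.{0} R) : Prop where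
  map_add {c d : A.Total} (i : c.base ⟶ d.base)
    (a b : (A.F.map i.toLoc).toFunctor.obj c.fiber ⟶ d.fiber) :
    N.map (A.homMk i (a + b)).op.op = N.map (A.homMk i a).op.op + N.map (A.homMk i b).op.op
  map_smul {c d : A.Total} (i : c.base ⟶ d.base) (r : R)
    (a : (A.F.map i.toLoc).toFunctor.obj c.fiber ⟶ d.fiber) :
    N.map (A.homMk i (r • a)).op.op = r • N.map (A.homMk i a).op.op

/-- The linear sheaves of `R`-modules on the total category. -/
def isModule : ObjectProperty (Sheaf A.topology (ModuleCat.{0} R)) := fun N => A.IsLinear N.obj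

variable {A} in
lemma IsLinear.of_injective {M N : A.Siteᵒᵖ ⥤ ModuleCat.{0} R} (f : M ⟶ N)
    (hf : ∀ c, Mono (f.app c)) (hN : A.IsLinear N) : A.IsLinear M where
  map_add i a b := by
    rw [← cancel_mono (f.app _)]
    simp only [Preadditive.add_comp, NatTrans.naturality, hN.map_add, Preadditive.comp_add]
  map_smul i r a := by
    rw [← cancel_mono (f.app _)]
    simp only [Linear.smul_comp, NatTrans.naturality, hN.map_smul, Linear.comp_smul]

instance : A.isModule.IsClosedUnderSubobjects where
  prop_of_mono {M N} f _ hN := by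
    have : Mono f.hom := inferInstanceAs (Mono ((sheafToPresheaf _ _).map f))
    exact IsLinear.of_injective f.hom (fun c => inferInstance) hN

lemma eq_of_locally_eq (N : Sheaf A.topology (ModuleCat.{0} R)) {d : A.Total}
    (y z : N.obj.obj (op (op d)))
    (h : ∀ x ∈ d.base.unop, ∃ (W : Opens X) (j : W ⟶ d.base.unop), x ∈ W ∧
      N.obj.map (A.toRestrict d j).op.op y = N.obj.map (A.toRestrict d j).op.op z) : y = z := by
  have hN : Presieve.IsSheaf A.topology (N.obj ⋙ forget _) :=
    (isSheaf_iff_isSheaf_of_type _ _).1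
      ((Presheaf.isSheaf_iff_isSheaf_forget A.topology N.obj (forget _)).1 N.property)
  refine (hN.isSeparated (Presheaf.equalizerSieve (F := N.obj) y z) h).ext fun e f hf => hf

instance : A.isModule.IsClosedUnderQuotients where
  prop_of_epi {M N} f _ hM := by
    have hs := (Sheaf.isLocallySurjective_iff_epi' (J := A.topology) (A := ModuleCat.{0} R) f).2
      inferInstance
    have key {c d : A.Total} (i : c.base ⟶ d.base) (q : N.obj.obj (op (op c))) (x : X)
        (hx : x ∈ d.base.unop) : ∃ (W : Opens X) (j : W ⟶ d.base.unop) (e : A.Total)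
          (b : e.base ⟶ (A.restrict d j).base)
          (K : ((A.F.map i.toLoc).toFunctor.obj c.fiber ⟶ d.fiber) →ₗ[R]
            ((A.F.map b.toLoc).toFunctor.obj e.fiber ⟶ (A.restrict d j).fiber))
          (m : M.obj.obj (op (op e))), x ∈ W ∧
          ∀ a, N.obj.map (A.toRestrict d j).op.op (N.obj.map (A.homMk i a).op.op q) =
            f.hom.app _ (M.obj.map (A.homMk b (K a)).op.op m) := by
      obtain ⟨V, v, hxV, m, hm⟩ := Presheaf.imageSieve_mem A.topology f.hom q x (leOfHom i.unop hx)
      let j : V ⊓ d.base.unop ⟶ d.base.unop := homOfLE inf_le_right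
      obtain ⟨K₁, hK₁⟩ := A.exists_linear_comp i (A.toRestrict d j)
      obtain ⟨K₂, hK₂⟩ := A.exists_linear_fac (e := A.restrict d j) v (homOfLE inf_le_left)
        (i ≫ (A.toRestrict d j).base)
      refine ⟨_, j, A.restrict c v, _, K₂ ∘ₗ K₁, m, ⟨hxV, hx⟩, fun a => ?_⟩
      have e₁ : A.homMk i a ≫ A.toRestrict d j = A.toRestrict c v ≫ _ :=
        (hK₁ a).trans (hK₂ _).symm
      calc N.obj.map (A.toRestrict d j).op.op (N.obj.map (A.homMk i a).op.op q)
          = N.obj.map (A.homMk i a ≫ A.toRestrict d j).op.op q := by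
            rw [op_comp, op_comp, Functor.map_comp]; rfl
        _ = _ := by rw [e₁, op_comp, op_comp, Functor.map_comp]; rfl
        _ = N.obj.map _ (f.hom.app _ m) := congrArg _ hm.symm
        _ = _ := (NatTrans.naturality_apply f.hom _ m).symm
    constructor
    · intro c d i a b
      ext q
      refine A.eq_of_locally_eq N _ _ fun x hx => ?_
      obtain ⟨W, j, e, b', K, m, hxW, hK⟩ := key i q x hx
      refine ⟨W, j, hxW, ?_⟩
      have hM' : A.IsLinear M.obj := hM
      simp [hK, hM'.map_add]
    · intro c d i r a
      ext q
      refine A.eq_of_locally_eq N _ _ fun x hx => ?_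
      obtain ⟨W, j, e, b', K, m, hxW, hK⟩ := key i q x hx
      refine ⟨W, j, hxW, ?_⟩
      have hM' : A.IsLinear M.obj := hM
      simp [hK, hM'.map_smul]

instance (J : Type) [Category.{0} J] : A.isModule.IsClosedUnderLimitsOfShape J where
  limitsOfShape_le := by
    rintro M ⟨p⟩
    have hp (c) := isLimitOfPreserves (sheafToPresheaf A.topology (ModuleCat.{0} R) ⋙
      (evaluation _ _).obj c) p.isLimit
    have hn (j : J) {c d : A.Siteᵒᵖ} (f : c ⟶ d) : M.obj.map f ≫ (p.π.app j).hom.app d =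
        (p.π.app j).hom.app c ≫ (p.diag.obj j).obj.map f := (p.π.app j).hom.naturality f
    constructor
    · intro c d i a b
      refine (hp _).hom_ext fun j => ?_
      have hj : A.IsLinear (p.diag.obj j).obj := p.prop_diag_obj j
      change _ ≫ (p.π.app j).hom.app _ = _ ≫ (p.π.app j).hom.app _
      rw [hn, Preadditive.add_comp, hn, hn, ← Preadditive.comp_add, ← hj.map_add]
    · intro c d i r a
      refine (hp _).hom_ext fun j => ?_
      have hj : A.IsLinear (p.diag.obj j).obj := p.prop_diag_obj j
      change _ ≫ (p.π.app j).hom.app _ = _ ≫ (p.π.app j).hom.app _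
      rw [hn, Linear.smul_comp, hn, ← Linear.comp_smul, ← hj.map_smul]

instance : A.isModule.IsClosedUnderFiniteProducts where

instance : A.isModule.ContainsZero where
  exists_zero := ⟨⊤_ _, (isZero_zero _).of_iso (HasZeroObject.zeroIsoTerminal).symm, A.isModule.prop_terminal⟩

/-- The category `Mod(𝒜)` of (left) modules over the algebroid stack `𝒜`, that is, of `R`-linear
functors of stacks `M` from `𝒜` to the stack `V ↦ Mod(R_V)` of sheaves of `R`-modules.
Such an `M` is recorded through the groups of sections `(U, σ) ↦ Γ(U; M(σ))`. They are functorial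
for restrictions (as `M(σ|_V) = M(σ)|_V`) and for morphisms `σ ⟶ τ` in `𝒜(U)`, `R`-linearly in
the latter, and `V ↦ Γ(V; M(σ|_V))` is the sheaf `M(σ)` on `U`; these data determine `M`.
When `𝒜` is the algebroid stack of a sheaf of `R`-algebras, this is the category of left modules
over that sheaf. -/
abbrev Mod : Type 1 := A.isModule.FullSubcategory

instance : Abelian A.Mod := inferInstance

/-- The `R`-module of morphisms from `c = (U, σ)` to `d = (V, τ)`: it is `Hom(σ|_V, τ)` if `V ⊆ U`,
and `0` otherwise (there is at most one index `i`). -/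
def homModule (c d : A.Total) : Type :=
  ⨁ i : c.base ⟶ d.base, ((A.F.map i.toLoc).toFunctor.obj c.fiber ⟶ d.fiber)

instance (c d : A.Total) : AddCommGroup (A.homModule c d) :=
  inferInstanceAs (AddCommGroup
    (⨁ i : c.base ⟶ d.base, ((A.F.map i.toLoc).toFunctor.obj c.fiber ⟶ d.fiber)))

instance (c d : A.Total) : Module R (A.homModule c d) :=
  inferInstanceAs (Module R
    (⨁ i : c.base ⟶ d.base, ((A.F.map i.toLoc).toFunctor.obj c.fiber ⟶ d.fiber)))

/-- The inclusion of the summand of index `i`. -/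
def ι {c d : A.Total} (i : c.base ⟶ d.base) :
    ((A.F.map i.toLoc).toFunctor.obj c.fiber ⟶ d.fiber) →ₗ[R] A.homModule c d :=
  DirectSum.lof R (c.base ⟶ d.base)
    (fun i => ((A.F.map i.toLoc).toFunctor.obj c.fiber ⟶ d.fiber)) i

/-- A morphism of the total category as an element of `homModule`. -/
def single {c d : A.Total} (f : c ⟶ d) : A.homModule c d := A.ι f.base f.fiber

/-- The linear map out of `homModule` with the given components. -/
def desc {c d : A.Total} {N : Type} [AddCommGroup N] [Module R N]
    (φ : ∀ i : c.base ⟶ d.base, ((A.F.map i.toLoc).toFunctor.obj c.fiber ⟶ d.fiber) →ₗ[R] N) :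
    A.homModule c d →ₗ[R] N :=
  DirectSum.toModule R _ N φ

@[simp]
lemma desc_single {c d : A.Total} {N : Type} [AddCommGroup N] [Module R N]
    (φ : ∀ i : c.base ⟶ d.base, ((A.F.map i.toLoc).toFunctor.obj c.fiber ⟶ d.fiber) →ₗ[R] N)
    (f : c ⟶ d) : A.desc φ (A.single f) = φ f.base f.fiber := by
  exact DirectSum.toModule_lof R _ _

lemma homModule_ext {c d : A.Total} {N : Type} [AddCommGroup N] [Module R N]
    {φ ψ : A.homModule c d →ₗ[R] N} (h : ∀ f : c ⟶ d, φ (A.single f) = ψ (A.single f)) :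
    φ = ψ := by
  refine DirectSum.linearMap_ext (M := fun i : c.base ⟶ d.base =>
    ((A.F.map i.toLoc).toFunctor.obj c.fiber ⟶ d.fiber)) R fun i => ?_
  ext a
  exact h (A.homMk i a)

/-- Composition with `g` on the target side. -/
def postcomp (c : A.Total) {d e : A.Total} (g : d ⟶ e) : A.homModule c d →ₗ[R] A.homModule c e :=
  A.desc fun i => A.ι (i ≫ g.base) ∘ₗ
    Linear.leftComp R _ ((A.F.mapComp i.toLoc g.base.toLoc).hom.toNatTrans.app c.fiber) ∘ₗ
    Linear.rightComp R _ g.fiber ∘ₗ (A.F.map g.base.toLoc).toFunctor.mapLinearMap R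

/-- Composition with `g` on the source side. -/
def precomp {b c : A.Total} (g : b ⟶ c) (d : A.Total) : A.homModule c d →ₗ[R] A.homModule b d :=
  A.desc fun i => A.ι (g.base ≫ i) ∘ₗ
    Linear.leftComp R _ ((A.F.mapComp g.base.toLoc i.toLoc).hom.toNatTrans.app b.fiber ≫
      (A.F.map i.toLoc).toFunctor.map g.fiber)

@[simp]
lemma postcomp_single {c d e : A.Total} (f : c ⟶ d) (g : d ⟶ e) :
    A.postcomp c g (A.single f) = A.single (f ≫ g) := by
  rw [postcomp, desc_single]; rfl

@[simp]
lemma precomp_single {b c d : A.Total} (g : b ⟶ c) (f : c ⟶ d) :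
    A.precomp g d (A.single f) = A.single (g ≫ f) := by
  rw [precomp, desc_single]
  exact congrArg (A.ι (g.base ≫ f.base)) (Category.assoc _ _ _)

/-- `𝒜` as a bimodule over itself. For `c = (U, τ)` the functor `A.bimodule.obj c` is the presheaf
whose sections over `(V, σ)` are `Hom(τ|_V, σ)` if `V ⊆ U` and `0` otherwise; so it is the extension
by zero of the left `𝒜|_U`-module `𝒜(τ, ·)`. -/
def bimodule : A.Site ⥤ A.Siteᵒᵖ ⥤ ModuleCat.{0} R where
  obj c :=
    { obj d := ModuleCat.of R (A.homModule c.unop d.unop.unop)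
      map g := ModuleCat.ofHom (A.postcomp c.unop g.unop.unop)
      map_id d := by
        ext1; exact A.homModule_ext fun f => by simp
      map_comp g h := by
        ext1; exact A.homModule_ext fun f => by simp }
  map g :=
    { app d := ModuleCat.ofHom (A.precomp g.unop d.unop.unop)
      naturality d e h := by
        ext1; exact A.homModule_ext fun f => by simp }
  map_id c := by
    ext d : 3; exact A.homModule_ext fun f => by simp
  map_comp g h := by
    ext d : 3; exact A.homModule_ext fun f => by simp

variable (L : ModuleCat.{0} R)

/-- The bimodule `L ⊗_R 𝒜` (as a presheaf). -/
def tensorBimodule : A.Site ⥤ A.Siteᵒᵖ ⥤ ModuleCat.{0} R :=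
  A.bimodule ⋙ (Functor.whiskeringRight _ _ _).obj (MonoidalCategory.tensorLeft L)

/-- `ℋom_𝒜(L ⊗_R 𝒜, N)`: its sections over `(U, τ)` are the morphisms from the extension by zero of
the `𝒜|_U`-module `L ⊗_R 𝒜(τ, ·)` to `N`, i.e. the morphisms of `𝒜|_U`-modules from
`L ⊗_R 𝒜(τ, ·)` to `N|_U`. It is an `𝒜`-module through the contravariant dependence of `𝒜(τ, ·)`
on `τ`. (If `N` is a sheaf, it makes no difference whether `L ⊗_R 𝒜(τ, ·)` is sheafified.) -/
def homFunctor : (A.Siteᵒᵖ ⥤ ModuleCat.{0} R) ⥤ (A.Siteᵒᵖ ⥤ ModuleCat.{0} R) :=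
  linearYoneda R _ ⋙ (Functor.whiskeringLeft _ _ _).obj (A.tensorBimodule L).op

/-- The element `l ⊗ f`. -/
def tmul {c : A.Site} {d : A.Siteᵒᵖ} (l : L) (f : c.unop ⟶ d.unop.unop) :
    ((A.tensorBimodule L).obj c).obj d :=
  (TensorProduct.tmul R l (A.single f) :
    TensorProduct R L (A.homModule c.unop d.unop.unop))

lemma tensorBimodule_obj_map_tmul (c : A.Site) {d e : A.Siteᵒᵖ} (g : d ⟶ e)
    (l : L) (f : c.unop ⟶ d.unop.unop) :
    ((A.tensorBimodule L).obj c).map g (A.tmul L l f) = A.tmul L l (f ≫ g.unop.unop) :=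
  congrArg (TensorProduct.tmul R l) (A.postcomp_single f g.unop.unop)

lemma tensorBimodule_map_app_tmul {b c : A.Site} (g : b ⟶ c) (d : A.Siteᵒᵖ)
    (l : L) (f : b.unop ⟶ d.unop.unop) :
    ((A.tensorBimodule L).map g).app d (A.tmul L l f) = A.tmul L l (g.unop ≫ f) :=
  congrArg (TensorProduct.tmul R l) (A.precomp_single g.unop f)

lemma tensorBimodule_ext {c : A.Site} {d : A.Siteᵒᵖ} {N : ModuleCat.{0} R}
    {φ ψ : ((A.tensorBimodule L).obj c).obj d ⟶ N}
    (h : ∀ (l : L) (f : c.unop ⟶ d.unop.unop), φ (A.tmul L l f) = ψ (A.tmul L l f)) :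
    φ = ψ := by
  ext1
  refine TensorProduct.ext (LinearMap.ext fun l => ?_)
  exact A.homModule_ext fun f => h l f

lemma precomp_homMk_add {c d : A.Total} (i : c.base ⟶ d.base)
    (a b : (A.F.map i.toLoc).toFunctor.obj c.fiber ⟶ d.fiber) (e : A.Total) :
    A.precomp (A.homMk i (a + b)) e = A.precomp (A.homMk i a) e + A.precomp (A.homMk i b) e := by
  refine A.homModule_ext fun f => ?_
  obtain ⟨K, hK⟩ := A.exists_linear_comp i f
  rw [LinearMap.add_apply, precomp_single, precomp_single, precomp_single, hK, hK, hK, map_add]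
  exact map_add (A.ι _) _ _

lemma precomp_homMk_smul {c d : A.Total} (i : c.base ⟶ d.base) (r : R)
    (a : (A.F.map i.toLoc).toFunctor.obj c.fiber ⟶ d.fiber) (e : A.Total) :
    A.precomp (A.homMk i (r • a)) e = r • A.precomp (A.homMk i a) e := by
  refine A.homModule_ext fun f => ?_
  obtain ⟨K, hK⟩ := A.exists_linear_comp i f
  rw [LinearMap.smul_apply, precomp_single, precomp_single, hK, hK, map_smul]
  exact map_smul (A.ι _) _ _

lemma isLinear_homFunctor (N : A.Siteᵒᵖ ⥤ ModuleCat.{0} R) :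
    A.IsLinear ((A.homFunctor L).obj N) where
  map_add {c d} i a b := by
    have : (A.tensorBimodule L).map (A.homMk i (a + b)).op =
        (A.tensorBimodule L).map (A.homMk i a).op + (A.tensorBimodule L).map (A.homMk i b).op := by
      ext e : 2
      refine A.tensorBimodule_ext L fun l f => ?_
      change TensorProduct.tmul R l (A.precomp (A.homMk i (a + b)) _ (A.single f)) =
        TensorProduct.tmul R l (A.precomp (A.homMk i a) _ (A.single f)) +
        TensorProduct.tmul R l (A.precomp (A.homMk i b) _ (A.single f))
      rw [precomp_homMk_add, LinearMap.add_apply, TensorProduct.tmul_add]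
    ext f
    change (A.tensorBimodule L).obj (op c) ⟶ N at f
    exact (congrArg (· ≫ f) this).trans (Preadditive.add_comp _ _ _ _ _ _)
  map_smul {c d} i r a := by
    have : (A.tensorBimodule L).map (A.homMk i (r • a)).op =
        r • (A.tensorBimodule L).map (A.homMk i a).op := by
      ext e : 2
      refine A.tensorBimodule_ext L fun l f => ?_
      change TensorProduct.tmul R l (A.precomp (A.homMk i (r • a)) _ (A.single f)) =
        r • TensorProduct.tmul R l (A.precomp (A.homMk i a) _ (A.single f))
      rw [precomp_homMk_smul, LinearMap.smul_apply, TensorProduct.tmul_smul]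
    ext f
    change (A.tensorBimodule L).obj (op c) ⟶ N at f
    exact (congrArg (· ≫ f) this).trans (Linear.smul_comp _ _ _ _ _ _)

/-- The map `l ↦ l ⊗ 𝟙`. -/
def unitMap (c : A.Siteᵒᵖ) : L ⟶ ((A.tensorBimodule L).obj c.unop).obj c :=
  ModuleCat.ofHom ((TensorProduct.mk R L (A.homModule c.unop.unop c.unop.unop)).flip
    (A.single (𝟙 c.unop.unop)))

/-- Evaluation at the identities. -/
def evalAtUnit (N : A.Siteᵒᵖ ⥤ ModuleCat.{0} R) : (A.homFunctor L).obj N ⟶ N ⋙ ihom L where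
  app c := ModuleCat.ofHom
    { toFun f := A.unitMap L c ≫ NatTrans.app (show (A.tensorBimodule L).obj c.unop ⟶ N from f) c
      map_add' f g := Preadditive.comp_add _ _ _ _ _ _
      map_smul' r f := Linear.comp_smul _ _ _ _ _ _ }
  naturality c d g := by
    ext f
    change A.unitMap L d ≫ ((A.tensorBimodule L).map g.unop).app d ≫ NatTrans.app f d =
      (A.unitMap L c ≫ NatTrans.app f c) ≫ N.map g
    change (A.tensorBimodule L).obj c.unop ⟶ N at f
    rw [Category.assoc, ← f.naturality, ← Category.assoc, ← Category.assoc]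
    congr 1
    ext l
    refine (A.tensorBimodule_map_app_tmul L g.unop d l (𝟙 _)).trans
      (Eq.trans ?_ (A.tensorBimodule_obj_map_tmul L c.unop g l (𝟙 _)).symm)
    rw [Category.comp_id, Category.id_comp]

variable {A} in
lemma isIso_evalAtUnit {N : A.Siteᵒᵖ ⥤ ModuleCat.{0} R} (hN : A.IsLinear N) :
    IsIso (A.evalAtUnit L N) := by
  rw [NatTrans.isIso_iff_isIso_app]
  intro c
  rw [ConcreteCategory.isIso_iff_bijective]
  constructor
  · intro f g h
    change (A.tensorBimodule L).obj c.unop ⟶ N at f g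
    change A.unitMap L c ≫ f.app c = A.unitMap L c ≫ g.app c at h
    refine NatTrans.ext (funext fun d => ?_)
    refine A.tensorBimodule_ext L fun l k => ?_
    have hk := A.tensorBimodule_obj_map_tmul L c.unop (d := c) (e := d) k.op.op l (𝟙 _)
    rw [Category.id_comp] at hk
    change _ = A.tmul L l k at hk
    rw [← hk]
    refine (NatTrans.naturality_apply f _ _).trans
      (Eq.trans (congrArg _ ?_) (NatTrans.naturality_apply g _ _).symm)
    exact congrArg (fun t : L ⟶ N.obj c => t l) h
  · intro ψ
    change L ⟶ N.obj c at ψ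
    let Φ (d : A.Siteᵒᵖ) : A.homModule c.unop.unop d.unop.unop →ₗ[R] L →ₗ[R] N.obj d :=
      A.desc fun i =>
        { toFun a := (N.map (A.homMk i a).op.op).hom ∘ₗ ψ.hom
          map_add' a b := by rw [hN.map_add]; rfl
          map_smul' r a := by rw [hN.map_smul]; rfl }
    have hΦ (d : A.Siteᵒᵖ) (f : c.unop.unop ⟶ d.unop.unop) (l : L) :
        Φ d (A.single f) l = N.map f.op.op (ψ l) := by
      simp only [Φ, desc_single]; rfl
    let f : (A.tensorBimodule L).obj c.unop ⟶ N :=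
      { app d := ModuleCat.ofHom (TensorProduct.lift (Φ d).flip)
        naturality d e g := by
          refine A.tensorBimodule_ext L fun l k => ?_
          refine (congrArg (TensorProduct.lift (Φ e).flip)
            (A.tensorBimodule_obj_map_tmul L c.unop g l k)).trans ?_
          change Φ e (A.single (k ≫ g.unop.unop)) l = N.map g (Φ d (A.single k) l)
          rw [hΦ, hΦ, op_comp, op_comp, Functor.map_comp]
          rfl }
    refine ⟨f, ?_⟩
    change A.unitMap L c ≫ f.app c = ψ
    ext l
    change Φ c (A.single (𝟙 _)) l = ψ l
    rw [hΦ, op_id, op_id]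
    exact congrArg (fun t : N.obj c ⟶ N.obj c => t (ψ l)) (N.map_id c)

lemma isSheaf_homFunctor (N : A.Mod) :
    Presheaf.IsSheaf A.topology ((A.homFunctor L).obj N.obj.obj) := by
  have := isIso_evalAtUnit L N.property
  have : PreservesLimits (ihom L) := (ihom.adjunction L).rightAdjoint_preservesLimits
  exact (Presheaf.isSheaf_of_iso_iff (asIso (A.evalAtUnit L N.obj.obj))).2
    (Presheaf.isSheaf_comp_of_isSheaf A.topology N.obj.obj (ihom L) N.obj.property)

/-- The left exact functor `ℋom_𝒜(L ⊗_R 𝒜, ·) : Mod(𝒜) ⥤ Mod(𝒜)`. -/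
def homMod : A.Mod ⥤ A.Mod :=
  A.isModule.lift (ObjectProperty.lift _
    (A.isModule.ι ⋙ sheafToPresheaf _ _ ⋙ A.homFunctor L) fun N => A.isSheaf_homFunctor L N)
    fun N => A.isLinear_homFunctor L N.obj.obj

instance : (A.homMod L).Additive where
  map_add {M N f g} := by
    refine A.isModule.hom_ext (ObjectProperty.hom_ext _ (NatTrans.ext (funext fun c => ?_)))
    ext h
    exact Preadditive.comp_add (C := A.Siteᵒᵖ ⥤ ModuleCat.{0} R) _ _ _ h f.hom.hom g.hom.hom

/-- `N` is a value at `M` of the right derived functor `Rℋom_𝒜(L ⊗_R 𝒜, ·) : D(𝒜) → D(𝒜)` of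
`ℋom_𝒜(L ⊗_R 𝒜, ·)`: for a K-injective complex `I` representing `M`, the complex
`ℋom_𝒜(L ⊗_R 𝒜, I)` represents `N`. -/
def IsRHom [HasDerivedCategory.{w} A.Mod] (M N : DerivedCategory A.Mod) : Prop :=
  ∃ I : CochainComplex A.Mod ℤ, I.IsKInjective ∧ Nonempty (DerivedCategory.Q.obj I ≅ M) ∧
    Nonempty (DerivedCategory.Q.obj
      (((A.homMod L).mapHomologicalComplex (ComplexShape.up ℤ)).obj I) ≅ N)

/-- Over `W ⊆ U`, the endomorphisms of the restriction of `σ ∈ 𝒜(U)`. -/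
abbrev EndSec {U W : Opens X} (σ : A.F.obj (.mk (op U))) (h : W ≤ U) : Type :=
  (A.F.map (homOfLE h).op.toLoc).toFunctor.obj σ ⟶ (A.F.map (homOfLE h).op.toLoc).toFunctor.obj σ

/-- The restriction maps of the sheaf `ℰnd(σ)`. -/
def resEnd {U W W' : Opens X} (σ : A.F.obj (.mk (op U))) (h : W ≤ U) (h' : W' ≤ W)
    (a : A.EndSec σ h) : A.EndSec σ (h'.trans h) :=
  Pseudofunctor.LocallyDiscreteOpToCat.pullHom a (homOfLE h') (homOfLE (h'.trans h))
    (homOfLE (h'.trans h)) (Subsingleton.elim _ _) (Subsingleton.elim _ _)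

end Algebroid

/-- An isomorphism of sheaves of `ℂ⟦ħ⟧`-algebras over `V ⊆ U` from a star algebra `(𝒪⟦ħ⟧, ⋆)` to
`ℰnd(σ)`, where `σ ∈ 𝒜(U)`. -/
structure StarIso {X : CAlgSpace} (A : Algebroid ℂ⟦X⟧ X.space) {U V : Opens X.space}
    (σ : A.F.obj (.mk (op U))) (hV : V ≤ U) where
  star : StarProduct X V
  φ : ∀ (W : Opens X.space) (hW : W ≤ V), (X.Sec W)⟦X⟧ ≃ₗ[ℂ⟦X⟧] A.EndSec σ (hW.trans hV)
  map_res : ∀ (W W' : Opens X.space) (hW : W ≤ V) (h : W' ≤ W) (f : (X.Sec W)⟦X⟧),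
    φ W' (h.trans hW) (PowerSeries.map (X.res h) f) = A.resEnd σ (hW.trans hV) h (φ W hW f)
  map_one : ∀ (W : Opens X.space) (hW : W ≤ V), φ W hW 1 = 𝟙 _
  map_mul : ∀ (W : Opens X.space) (hW : W ≤ V) (f g : (X.Sec W)⟦X⟧),
    φ W hW (star.mul hW f g) = φ W hW g ≫ φ W hW f

/-- A DQ-algebroid on `X`: a `ℂ⟦ħ⟧`-algebroid stack such that for every local object `σ`, the sheaf
of `ℂ⟦ħ⟧`-algebras `ℰnd(σ)` is a DQ-algebra, i.e. locally isomorphic to a star algebra. -/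
structure DQAlgebroid (X : SmoothComplexVariety) extends
    Algebroid ℂ⟦X⟧ X.toCAlgSpace.space where
  isDQ : ∀ (U : Opens X.toCAlgSpace.space) (σ : F.obj (.mk (op U))) (x : X.toCAlgSpace.space),
    x ∈ U → ∃ (V : Opens X.toCAlgSpace.space) (hV : V ≤ U), x ∈ V ∧
      Nonempty (StarIso toAlgebroid σ hV)

namespace DQAlgebroid

variable {X : SmoothComplexVariety} (A : DQAlgebroid X)

/-- The category `Mod(𝒜_X)`. -/
abbrev Mod : Type 1 := A.toAlgebroid.Mod

/-- `N` is a value at `M` of `Rℋom_{𝒜_X}(𝒜_X^loc, ·) : D(𝒜_X) → D(𝒜_X)`, where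
`𝒜_X^loc = ℂ((ħ)) ⊗_{ℂ⟦ħ⟧} 𝒜_X`. -/
def IsRHomLoc [HasDerivedCategory.{w} A.Mod] (M N : DerivedCategory A.Mod) : Prop :=
  A.toAlgebroid.IsRHom (ModuleCat.of ℂ⟦X⟧ ℂ⸨X⸩) M N

end DQAlgebroid

end DQ

end

/- Put `r = ħ`. The localization `R[r⁻¹]` has a resolution `0 ⟶ ⨁ R ⟶ ⨁ R ⟶ R[r⁻¹] ⟶ 0` by free
modules of countable rank, the telescope. If `I` is K-injective, a local section of degree `j` of
`ℋom(𝒜^loc, I)` is therefore a coboundary near a given point as soon as countably many cocycles of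
`I`, in the degrees `j` and `j - 1`, are coboundaries on one and the same neighbourhood of this
point. Exactness of `I` in the degrees larger than `b` gives such a neighbourhood for every single
cocycle, but it depends on the cocycle. A neighbourhood of a point which has finite dimension (a
Noetherian space of finite Krull dimension, or a compact subset of `ℝ^d`) works for all cocycles of
degree larger than `b + d`: Mayer-Vietoris arguments glue the local primitives and lower the
dimension by one together with the degree. Hence the cohomology of `ℋom(𝒜^loc, I)` vanishes in the
degrees larger than `b + d + 1`. -/

noncomputable section

namespace DQ

section KInjective

variable {C : Type*} [Category* C] [Abelian C]

/-- The terms of `threeTerm S`. -/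
def threeTermX (S : ShortComplex C) : ℤ → C
  | .ofNat 0 => S.X₃
  | .negSucc 0 => S.X₂
  | .negSucc 1 => S.X₁
  | .ofNat (_ + 1) => 0
  | .negSucc (_ + 2) => 0

/-- The differentials of `threeTerm S`. -/
def threeTermD (S : ShortComplex C) : ∀ n : ℤ, threeTermX S n ⟶ threeTermX S (n + 1)
  | .negSucc 0 => S.g
  | .negSucc 1 => S.f
  | .ofNat _ => 0
  | .negSucc (_ + 2) => 0

/-- The complex `S.X₁ ⟶ S.X₂ ⟶ S.X₃` placed in degrees `-2`, `-1`, `0`. -/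
def threeTerm (S : ShortComplex C) : CochainComplex C ℤ :=
  CochainComplex.of (threeTermX S) (threeTermD S) (by
    rintro (n | _ | _ | n)
    · exact zero_comp
    · exact comp_zero
    · exact S.zero
    · exact zero_comp)

lemma threeTerm_d (S : ShortComplex C) (n : ℤ) : (threeTerm S).d n (n + 1) = threeTermD S n :=
  CochainComplex.of_d _ _ _

lemma acyclic_threeTerm {S : ShortComplex C} (hS : S.ShortExact) : (threeTerm S).Acyclic := by
  have exactAt_of_isZero (n : ℤ) (hn : IsZero (threeTermX S n)) : (threeTerm S).ExactAt n :=
    ShortComplex.exact_of_isZero_X₂ _ hn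
  have exactAt (n : ℤ) (h : ((threeTerm S).sc' (n - 1) n (n + 1)).Exact) :
      (threeTerm S).ExactAt n :=
    (HomologicalComplex.exactAt_iff' _ _ _ _ (by simp) (by simp)).2 h
  have hf : (threeTerm S).d (-2) (-1) = S.f := threeTerm_d S (-2)
  have hg : (threeTerm S).d (-1) 0 = S.g := threeTerm_d S (-1)
  rintro ((_ | n) | (_ | _ | n))
  · refine exactAt 0 ((ShortComplex.exact_iff_epi _ (threeTerm_d S 0)).2 ?_)
    exact (congrArg Epi hg).mpr hS.epi_g
  · exact exactAt_of_isZero _ (isZero_zero C)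
  · refine exactAt (-1) ((ShortComplex.exact_iff_of_iso ?_).1 hS.exact)
    exact ShortComplex.isoMk (Iso.refl _) (Iso.refl _) (Iso.refl _)
      ((Category.id_comp _).trans (hf.trans (Category.comp_id S.f).symm))
      ((Category.id_comp _).trans (hg.trans (Category.comp_id S.g).symm))
  · refine exactAt (-2) ((ShortComplex.exact_iff_mono _ (threeTerm_d S (-3))).2 ?_)
    exact (congrArg Mono hf).mpr hS.mono_f
  · exact exactAt_of_isZero _ (isZero_zero C)

/-- The morphism from `threeTerm S` with the given components. -/
def threeTermDesc {K : CochainComplex C ℤ} {S : ShortComplex C} (φ : S.X₃ ⟶ K.X 0)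
    (ψ : S.X₂ ⟶ K.X (-1)) (χ : S.X₁ ⟶ K.X (-2)) (hφ : φ ≫ K.d 0 1 = 0)
    (hψ : ψ ≫ K.d (-1) 0 = S.g ≫ φ) (hχ : χ ≫ K.d (-2) (-1) = S.f ≫ ψ) :
    threeTerm S ⟶ K :=
  CochainComplex.ofHom (fun
    | .ofNat 0 => φ
    | .negSucc 0 => ψ
    | .negSucc 1 => χ
    | .ofNat (_ + 1) => 0
    | .negSucc (_ + 2) => 0) (by
    intro n
    rw [threeTerm_d]
    obtain ((_ | n) | (_ | _ | _ | n)) := n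
    · exact hφ.trans zero_comp.symm
    · exact zero_comp.trans zero_comp.symm
    · exact hψ
    · exact hχ
    · exact zero_comp.trans zero_comp.symm
    · exact zero_comp.trans zero_comp.symm)

variable {I : CochainComplex C ℤ} [I.IsKInjective] {S : ShortComplex C}

lemma exists_comp_d_eq_degree_zero (hS : S.ShortExact) (φ : S.X₃ ⟶ I.X 0) (ψ : S.X₂ ⟶ I.X (-1))
    (χ : S.X₁ ⟶ I.X (-2)) (hφ : φ ≫ I.d 0 1 = 0) (hψ : ψ ≫ I.d (-1) 0 = S.g ≫ φ)
    (hχ : χ ≫ I.d (-2) (-1) = S.f ≫ ψ) : ∃ θ : S.X₃ ⟶ I.X (-1), θ ≫ I.d (-1) 0 = φ := by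
  obtain ⟨H⟩ := CochainComplex.IsKInjective.nonempty_homotopy_zero
    (threeTermDesc φ ψ χ hφ hψ hχ) (acyclic_threeTerm hS)
  have comm := H.comm 0
  rw [dNext_eq _ (show (ComplexShape.up ℤ).Rel 0 1 from rfl),
    prevD_eq _ (show (ComplexShape.up ℤ).Rel (-1) 0 from rfl),
    show (threeTerm S).d 0 1 = 0 from threeTerm_d S 0, zero_comp, zero_add,
    HomologicalComplex.zero_f, add_zero] at comm
  exact ⟨H.hom 0 (-1), comm.symm⟩

lemma exists_comp_d_eq (hS : S.ShortExact) {h i j k : ℤ} (hi : h + 1 = i) (hj : i + 1 = j)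
    (hk : j + 1 = k) (φ : S.X₃ ⟶ I.X j) (ψ : S.X₂ ⟶ I.X i) (χ : S.X₁ ⟶ I.X h)
    (hφ : φ ≫ I.d j k = 0) (hψ : ψ ≫ I.d i j = S.g ≫ φ) (hχ : χ ≫ I.d h i = S.f ≫ ψ) :
    ∃ θ : S.X₃ ⟶ I.X i, θ ≫ I.d i j = φ := by
  obtain ⟨n, rfl⟩ : ∃ n, j = 0 + n := ⟨j, (zero_add j).symm⟩
  obtain rfl : i = -1 + n := by omega
  obtain rfl : h = -2 + n := by omega
  obtain rfl : k = 1 + n := by omega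
  have hφ' : φ ≫ (n.negOnePow • I.d (0 + n) (1 + n)) = 0 := by
    rw [Linear.comp_units_smul, hφ, smul_zero]
  have hψ' : (n.negOnePow • ψ) ≫ (n.negOnePow • I.d (-1 + n) (0 + n)) = S.g ≫ φ := by
    rw [Linear.comp_units_smul, Linear.units_smul_comp, smul_smul, Int.units_mul_self, one_smul,
      hψ]
  have hχ' : χ ≫ (n.negOnePow • I.d (-2 + n) (-1 + n)) = S.f ≫ (n.negOnePow • ψ) := by
    rw [Linear.comp_units_smul, Linear.comp_units_smul, hχ]
  obtain ⟨θ, hθ⟩ : ∃ θ : S.X₃ ⟶ I.X (-1 + n), θ ≫ (n.negOnePow • I.d (-1 + n) (0 + n)) = φ :=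
    exists_comp_d_eq_degree_zero (I := I⟦n⟧) hS φ _ χ hφ' hψ' hχ'
  exact ⟨n.negOnePow • θ, by rw [Linear.units_smul_comp, ← Linear.comp_units_smul, hθ]⟩

lemma exists_comp_d_eq_of_isPushout {X₁ X₂ X₃ X₄ : C} {t : X₁ ⟶ X₂} {l : X₁ ⟶ X₃} {r : X₂ ⟶ X₄}
    {b : X₃ ⟶ X₄} (sq : IsPushout t l r b) [Mono t] {h i j k : ℤ} (hi : h + 1 = i)
    (hj : i + 1 = j) (hk : j + 1 = k) (φ : X₄ ⟶ I.X j) (ψ₂ : X₂ ⟶ I.X i) (ψ₃ : X₃ ⟶ I.X i)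
    (χ : X₁ ⟶ I.X h) (hφ : φ ≫ I.d j k = 0) (hψ₂ : ψ₂ ≫ I.d i j = r ≫ φ)
    (hψ₃ : ψ₃ ≫ I.d i j = b ≫ φ) (hχ : χ ≫ I.d h i = t ≫ ψ₂ - l ≫ ψ₃) :
    ∃ θ : X₄ ⟶ I.X i, θ ≫ I.d i j = φ := by
  have : Mono (biprod.lift t (-l)) :=
    have : Mono (biprod.lift t (-l) ≫ biprod.fst) := by rwa [biprod.lift_fst]
    mono_of_mono _ biprod.fst
  have hS : sq.shortComplex.ShortExact :=
    { exact := sq.exact_shortComplex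
      mono_f := this
      epi_g := sq.epi_shortComplex_g }
  have hψ : biprod.desc ψ₂ ψ₃ ≫ I.d i j = biprod.desc r b ≫ φ := by
    ext <;> simp only [biprod.inl_desc_assoc, biprod.inr_desc_assoc, hψ₂, hψ₃]
  have hχ' : χ ≫ I.d h i = biprod.lift t (-l) ≫ biprod.desc ψ₂ ψ₃ := by
    rw [hχ, biprod.lift_desc, Preadditive.neg_comp, sub_eq_add_neg]
  exact exists_comp_d_eq hS hi hj hk φ _ χ hφ hψ hχ'

end KInjective

section MayerVietoris

/-- Graded classes on the open subsets of `X`, which can be restricted and may be null. A class on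
a union of two open subsets which is null on both of them has an obstruction to being null, one
degree lower and on their intersection, and all classes in degrees larger than `b` are locally
null. The classes to keep in mind are the cocycles of a complex of sheaves, the coboundaries being
null. -/
structure MayerVietorisTheory (X : Type) [TopologicalSpace X] (b : ℤ) where
  Cls : ℤ → Opens X → Type
  res {j : ℤ} {V W : Opens X} (h : V ≤ W) (s : Cls j W) : Cls j V
  Null {j : ℤ} {W : Opens X} (s : Cls j W) : Prop
  null_bot {j : ℤ} (s : Cls j ⊥) : Null s
  null_of_le {j : ℤ} {U V W : Opens X} {s : Cls j W} {h : V ≤ W} (hs : Null (res h s))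
    (h' : U ≤ V) : Null (res (h'.trans h) s)
  locally_null {j : ℤ} (hj : b < j) {W : Opens X} (s : Cls j W) {x : X} (hx : x ∈ W) :
    ∃ (V : Opens X) (h : V ≤ W), x ∈ V ∧ Null (res h s)
  mayerVietoris {j : ℤ} {W W₁ W₂ : Opens X} (s : Cls (j + 1) W) (h₁ : W₁ ≤ W) (h₂ : W₂ ≤ W)
    (hs₁ : Null (res h₁ s)) (hs₂ : Null (res h₂ s)) :
    ∃ u : Cls j (W₁ ⊓ W₂), ∀ (V₁ V₂ : Opens X) (hV₁ : V₁ ≤ W₁) (hV₂ : V₂ ≤ W₂),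
      Null (res (inf_le_inf hV₁ hV₂) u) →
        Null (res (sup_le (hV₁.trans h₁) (hV₂.trans h₂)) s)

variable {X : Type} [TopologicalSpace X] {b : ℤ}

namespace MayerVietorisTheory

/-- The class `s` is null on an open neighbourhood of `K`. -/
def NullNear (T : MayerVietorisTheory X b) {j : ℤ} {W : Opens X} (s : T.Cls j W) (K : Set X) :
    Prop :=
  ∃ (V : Opens X) (h : V ≤ W), K ⊆ V ∧ T.Null (T.res h s)

variable {T : MayerVietorisTheory X b} {j : ℤ} {W : Opens X} {s : T.Cls j W}

lemma NullNear.mono {K L : Set X} (hL : T.NullNear s L) (h : K ⊆ L) : T.NullNear s K :=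
  let ⟨V, hV, hLV, hs⟩ := hL
  ⟨V, hV, h.trans hLV, hs⟩

lemma NullNear.null_res {V : Opens X} (hs : T.NullNear s V) (h : V ≤ W) : T.Null (T.res h s) :=
  let ⟨_, _, hVU, hsU⟩ := hs
  T.null_of_le hsU hVU

lemma nullNear_empty : T.NullNear s ∅ :=
  ⟨⊥, bot_le, Set.empty_subset _, T.null_bot _⟩

end MayerVietorisTheory

/-- Every open neighbourhood `U` of a point contains a neighbourhood `V` of this point on which
all the classes on `U` of all Mayer-Vietoris theories are null in degrees larger than `b + d`. The
choice of `V` before the class is the point of this definition. -/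
def HasLocalDimLE (X : Type) [TopologicalSpace X] (d : ℕ) : Prop :=
  ∀ (U : Opens X), ∀ x ∈ U, ∃ (V : Opens X) (h : V ≤ U), x ∈ V ∧
    ∀ (b : ℤ) (T : MayerVietorisTheory X b) (j : ℤ) (s : T.Cls j U), b + d < j →
      T.Null (T.res h s)

section Noetherian

lemma exists_specializes_of_mem_closure [NoetherianSpace X] [QuasiSober X] {U F : Set X}
    (hU : IsOpen U) (hF : IsClosed F) {x : X} (hx : x ∈ closure (U ∩ F)) :
    ∃ y ∈ U ∩ F, y ⤳ x := by
  obtain ⟨S, hSfinite, hSclosed, hSirr, hS⟩ :=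
    NoetherianSpace.exists_finite_set_isClosed_irreducible hF
  have hUF : U ∩ F = ⋃ Z ∈ S, U ∩ Z := by rw [hS, Set.sUnion_eq_biUnion, Set.inter_iUnion₂]
  rw [hUF, hSfinite.closure_biUnion, Set.mem_iUnion₂] at hx
  obtain ⟨Z, hZ, hxZ⟩ := hx
  obtain ⟨z, hz⟩ := QuasiSober.sober (hSirr Z hZ) (hSclosed Z hZ)
  have hzU : z ∈ U := (hz.mem_open_set_iff hU).2
    ((closure_nonempty_iff.1 ⟨x, hxZ⟩).mono (Set.inter_comm U Z).subset)
  have hzF : z ∈ F := hS ▸ Set.mem_sUnion_of_mem hz.mem hZ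
  exact ⟨z, ⟨hzU, hzF⟩,
    hz.specializes ((hSclosed Z hZ).closure_subset_iff.2 Set.inter_subset_right hxZ)⟩

variable [NoetherianSpace X] [QuasiSober X] {codim : X → ℕ}
  (hcodim : ∀ x y : X, y ⤳ x → y ≠ x → codim y < codim x)

namespace MayerVietorisTheory

variable {T : MayerVietorisTheory X b} {j : ℤ} {W : Opens X}

include hcodim in
lemma nullNear_insert {n : ℕ} (hj : b ≤ j)
    (ih : ∀ (U : Opens X) (u : T.Cls j U), T.NullNear u {x | x ∈ U ∧ codim x < n})
    (s : T.Cls (j + 1) W) {V : Opens X} (hV : V ≤ W) (hs : T.Null (T.res hV s)) {x : X}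
    (hxW : x ∈ W) (hx : codim x ≤ n) (hxV : x ∉ V) :
    T.NullNear s (insert x (V : Set X)) := by
  obtain ⟨U, hU, hxU, hUs⟩ := T.locally_null (by omega) s hxW
  obtain ⟨u, hu⟩ := T.mayerVietoris s hV hU hs hUs
  obtain ⟨V', hV', hnV', hu'⟩ := ih _ u
  let Z : Set X := (V ⊓ U : Opens X) ∩ (V' : Set X)ᶜ
  -- The points of `V ⊓ U` specializing to `x` are of smaller codimension, hence in `V'`.
  have hxZ : x ∉ closure Z := fun hxcl => by
    obtain ⟨y, ⟨hy, hyV'⟩, hyx⟩ :=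
      exists_specializes_of_mem_closure (V ⊓ U).isOpen V'.isOpen.isClosed_compl hxcl
    have hlt := hcodim x y hyx fun h => hxV (h ▸ hy.1)
    exact hyV' (hnV' ⟨hy, hlt.trans_le hx⟩)
  let U' : Opens X := U ⊓ ⟨(closure Z)ᶜ, isClosed_closure.isOpen_compl⟩
  have hVU' : V ⊓ U' ≤ V' := fun y hy => by
    by_contra hyV'
    exact hy.2.2 (subset_closure ⟨⟨hy.1, hy.2.1⟩, hyV'⟩)
  refine ⟨V ⊔ U', _, ?_, hu V U' le_rfl inf_le_left (T.null_of_le hu' hVU')⟩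
  exact Set.insert_subset (Or.inr ⟨hxU, hxZ⟩) fun y hy => Or.inl hy

include hcodim in
lemma nullNear_codim_lt (n : ℕ) (hj : b + n ≤ j) (s : T.Cls j W) :
    T.NullNear s {x | x ∈ W ∧ codim x < n} := by
  induction n generalizing j W with
  | zero => exact nullNear_empty.mono fun x hx => absurd hx.2 (Nat.not_lt_zero _)
  | succ n ih =>
    obtain ⟨j, rfl⟩ : ∃ i, j = i + 1 := ⟨j - 1, by ring⟩
    push_cast at hj
    obtain ⟨V, ⟨hV, hVs⟩, hmax⟩ := (wellFounded_gt (α := Opens X)).has_min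
      {V | ∃ h : V ≤ W, T.Null (T.res h s)} ⟨⊥, bot_le, T.null_bot _⟩
    refine ⟨V, hV, fun x ⟨hxW, hx⟩ => ?_, hVs⟩
    by_contra hxV
    obtain ⟨V', hV', hVV', hs'⟩ := nullNear_insert hcodim (by omega)
      (fun U u => ih (by omega) u) s hV hVs hxW (Nat.lt_succ_iff.1 hx) hxV
    have hlt : V < V' := lt_of_le_of_ne (fun y hy => hVV' (Or.inr hy)) fun h =>
      hxV (h ▸ hVV' (Or.inl rfl))
    exact hmax V' ⟨hV', hs'⟩ hlt

end MayerVietorisTheory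

include hcodim in
lemma hasLocalDimLE_of_noetherianSpace {d : ℕ} (hd : ∀ x, codim x ≤ d) : HasLocalDimLE X d :=
  fun U _ hx => ⟨U, le_rfl, hx, fun _ _ _ s hj =>
    ((MayerVietorisTheory.nullNear_codim_lt hcodim (d + 1) (by push_cast; omega) s).mono
      fun y hy => ⟨hy, Nat.lt_succ_iff.2 (hd y)⟩).null_res le_rfl⟩

end Noetherian

section Compact

lemma Icc_induction {P : Set ℝ → Prop} (mono : ∀ S S', S ⊆ S' → P S' → P S)
    (exists_nhd : ∀ t, ∃ S, IsOpen S ∧ t ∈ S ∧ P S)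
    (glue : ∀ a t c, a ≤ t → t ≤ c → P (Set.Icc a t) → P (Set.Icc t c) → P (Set.Icc a c))
    {a c : ℝ} (hac : a ≤ c) : P (Set.Icc a c) := by
  choose S hSopen hmem hPS using exists_nhd
  obtain ⟨r, hr₀, hr, ⟨m, hm⟩, hrS⟩ := exists_monotone_Icc_subset_open_cover_Icc hac
    (fun t => (hSopen t).preimage continuous_subtype_val)
    fun t _ => Set.mem_iUnion.2 ⟨t, hmem t⟩
  have hstep (n : ℕ) : P (Set.Icc (r n) (r (n + 1))) := by
    obtain ⟨t, ht⟩ := hrS n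
    exact mono _ _ (fun y hy => ht (a := ⟨y, (r n).2.1.trans hy.1, hy.2.trans (r (n + 1)).2.2⟩) hy)
      (hPS t)
  have hprefix (n : ℕ) : P (Set.Icc a (r n)) := by
    induction n with
    | zero =>
      rw [hr₀, Set.Icc_self]
      exact mono _ _ (Set.singleton_subset_iff.2 (hmem a)) (hPS a)
    | succ n ih => exact glue _ _ _ (r n).2.1 (hr n.le_succ) ih (hstep n)
  exact hm m le_rfl ▸ hprefix m

lemma isCompact_inter_preimage {K : Set X} (hK : IsCompact K) {f : X → ℝ} (hf : ContinuousOn f K)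
    {S : Set ℝ} (hS : IsClosed S) : IsCompact (K ∩ f ⁻¹' S) := by
  obtain ⟨F, hF, hFS⟩ := continuousOn_iff_isClosed.1 hf S hS
  rw [Set.inter_comm, hFS, Set.inter_comm]
  exact hK.inter_right hF

namespace MayerVietorisTheory

variable {T : MayerVietorisTheory X b} {j : ℤ} {W : Opens X} {O K : Set X}

lemma nullNear_inter_preimage_Icc (hO : IsOpen O) (hKO : K ⊆ O) {f : X → ℝ}
    (hf : ContinuousOn f O) (s : T.Cls (j + 1) W) {a t c : ℝ} (hat : a ≤ t) (htc : t ≤ c)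
    (hlevel : ∀ (U : Opens X) (u : T.Cls j U), K ∩ f ⁻¹' {t} ⊆ U →
      T.NullNear u (K ∩ f ⁻¹' {t}))
    (hs₁ : T.NullNear s (K ∩ f ⁻¹' Set.Icc a t)) (hs₂ : T.NullNear s (K ∩ f ⁻¹' Set.Icc t c)) :
    T.NullNear s (K ∩ f ⁻¹' Set.Icc a c) := by
  obtain ⟨W₁, hW₁, hKW₁, hs₁⟩ := hs₁
  obtain ⟨W₂, hW₂, hKW₂, hs₂⟩ := hs₂
  obtain ⟨u, hu⟩ := T.mayerVietoris s hW₁ hW₂ hs₁ hs₂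
  obtain ⟨V, hV, hKV, hVu⟩ := hlevel _ u fun x ⟨hx, (hxt : f x = t)⟩ =>
    ⟨hKW₁ ⟨hx, by rw [Set.mem_preimage, hxt]; exact ⟨hat, le_rfl⟩⟩,
      hKW₂ ⟨hx, by rw [Set.mem_preimage, hxt]; exact ⟨le_rfl, htc⟩⟩⟩
  let lower : Opens X := ⟨O ∩ f ⁻¹' Set.Iio t, hf.isOpen_inter_preimage hO isOpen_Iio⟩
  let upper : Opens X := ⟨O ∩ f ⁻¹' Set.Ioi t, hf.isOpen_inter_preimage hO isOpen_Ioi⟩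
  have hinf : (W₁ ⊓ (lower ⊔ V)) ⊓ (W₂ ⊓ (upper ⊔ V)) ≤ V := by
    rintro x ⟨⟨-, ⟨-, hlt⟩ | hxV⟩, ⟨-, ⟨-, hgt⟩ | hxV⟩⟩
    · exact (lt_asymm (show f x < t from hlt) hgt).elim
    all_goals assumption
  refine ⟨_, _, fun x ⟨hxK, hax, hxc⟩ => ?_,
    hu (W₁ ⊓ (lower ⊔ V)) (W₂ ⊓ (upper ⊔ V)) inf_le_left inf_le_left (T.null_of_le hVu hinf)⟩
  rcases lt_trichotomy (f x) t with hlt | heq | hgt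
  · exact Or.inl ⟨hKW₁ ⟨hxK, hax, hlt.le⟩, Or.inl ⟨hKO hxK, hlt⟩⟩
  · exact Or.inl ⟨hKW₁ ⟨hxK, hax, heq.le⟩, Or.inr (hKV ⟨hxK, heq⟩)⟩
  · exact Or.inr ⟨hKW₂ ⟨hxK, hgt.le, hxc⟩, Or.inl ⟨hKO hxK, hgt⟩⟩

lemma nullNear_of_levels (hO : IsOpen O) (hKO : K ⊆ O) (hK : IsCompact K) {f : X → ℝ}
    (hf : ContinuousOn f O) (s : T.Cls (j + 1) W)
    (hs : ∀ t, T.NullNear s (K ∩ f ⁻¹' {t}))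
    (hlevel : ∀ t (U : Opens X) (u : T.Cls j U), K ∩ f ⁻¹' {t} ⊆ U →
      T.NullNear u (K ∩ f ⁻¹' {t})) :
    T.NullNear s K := by
  have hfK : ContinuousOn f K := hf.mono hKO
  have exists_nhd (t : ℝ) : ∃ S, IsOpen S ∧ t ∈ S ∧ T.NullNear s (K ∩ f ⁻¹' S) := by
    obtain ⟨V, hV, hKV, hVs⟩ := hs t
    have hclosed : IsClosed (f '' (K \ V)) :=
      ((hK.diff V.isOpen).image_of_continuousOn (hfK.mono Set.sdiff_subset)).isClosed
    refine ⟨(f '' (K \ V))ᶜ, hclosed.isOpen_compl, ?_, V, hV, fun x hx => ?_, hVs⟩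
    · rintro ⟨x, hx, rfl⟩
      exact hx.2 (hKV ⟨hx.1, rfl⟩)
    · by_contra hxV
      exact hx.2 ⟨x, ⟨hx.1, hxV⟩, rfl⟩
  obtain ⟨C, hC⟩ := (hK.image_of_continuousOn hfK).isBounded.exists_norm_le
  have hKC : K ⊆ K ∩ f ⁻¹' Set.Icc (-|C|) |C| := fun x hx =>
    ⟨hx, abs_le.1 ((hC _ ⟨x, hx, rfl⟩).trans (le_abs_self C))⟩
  refine NullNear.mono (Icc_induction (P := fun S => T.NullNear s (K ∩ f ⁻¹' S))
    (fun S S' h hS' => hS'.mono (Set.inter_subset_inter_right K (Set.preimage_mono h)))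
    exists_nhd (fun a t c hat htc => ?_) (neg_le_self (abs_nonneg C))) hKC
  exact nullNear_inter_preimage_Icc hO hKO hf s hat htc (hlevel t)

lemma nullNear_of_isCompact {ι : Type} {f : ι → X → ℝ} (hO : IsOpen O)
    (hf : ∀ i, ContinuousOn (f i) O) (S : Finset ι) (hj : b + S.card < j) (s : T.Cls j W)
    (hK : IsCompact K) (hKO : K ⊆ O) (hKW : K ⊆ W)
    (hsep : ∀ x ∈ K, ∀ y ∈ K, (∀ i ∈ S, f i x = f i y) → x = y) : T.NullNear s K := by
  induction S using Finset.cons_induction generalizing j W K with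
  | empty =>
    obtain rfl | ⟨x, hx⟩ := K.eq_empty_or_nonempty
    · exact nullNear_empty
    · obtain ⟨V, hV, hxV, hs⟩ := T.locally_null (by simpa using hj) s (hKW hx)
      refine ⟨V, hV, fun y hy => ?_, hs⟩
      rwa [hsep y hy x hx fun i hi => absurd hi (Finset.notMem_empty i)]
  | cons i S hi ih =>
    obtain ⟨j, rfl⟩ : ∃ k, j = k + 1 := ⟨j - 1, by ring⟩
    rw [Finset.card_cons] at hj
    push_cast at hj
    have hlevel (t : ℝ) {k : ℤ} (hk : b + S.card < k) (U : Opens X) (u : T.Cls k U)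
        (hU : K ∩ f i ⁻¹' {t} ⊆ U) : T.NullNear u (K ∩ f i ⁻¹' {t}) := by
      refine ih hk u (isCompact_inter_preimage hK ((hf i).mono hKO) isClosed_singleton)
        (Set.inter_subset_left.trans hKO) hU fun x hx y hy hxy => hsep x hx.1 y hy.1 ?_
      exact Finset.forall_mem_cons hi _ |>.2 ⟨hx.2.trans hy.2.symm, hxy⟩
    exact nullNear_of_levels hO hKO hK (hf i) s
      (fun t => hlevel t (by omega) W s (Set.inter_subset_left.trans hKW))
      (fun t => hlevel t (by omega))

end MayerVietorisTheory

lemma hasLocalDimLE_of_chartedSpace (H : Type) [TopologicalSpace H] [LocallyCompactSpace H]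
    [ChartedSpace H X] {ι : Type} [Fintype ι] {f : ι → H → ℝ} (hf : ∀ i, Continuous (f i))
    (hsep : ∀ x y, (∀ i, f i x = f i y) → x = y) : HasLocalDimLE X (Fintype.card ι) := by
  intro U x hx
  have : LocallyCompactSpace X := ChartedSpace.locallyCompactSpace H X
  let e := chartAt H x
  obtain ⟨K, hKx, hKU, hK⟩ := local_compact_nhds
    ((U.isOpen.inter e.open_source).mem_nhds ⟨hx, mem_chart_source H x⟩)
  have hKsource : K ⊆ e.source := hKU.trans Set.inter_subset_right
  have hKU : K ⊆ U := hKU.trans Set.inter_subset_left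
  refine ⟨⟨interior K, isOpen_interior⟩, fun y hy => hKU (interior_subset hy),
    mem_interior_iff_mem_nhds.2 hKx, fun b T j s hj => ?_⟩
  have hs : T.NullNear s K := MayerVietorisTheory.nullNear_of_isCompact (f := fun i => f i ∘ e)
    e.open_source (fun i => (hf i).comp_continuousOn e.continuousOn) Finset.univ
    (by rwa [Finset.card_univ]) s hK hKsource hKU fun y hy z hz hyz =>
      e.injOn (hKsource hy) (hKsource hz) (hsep _ _ fun i => hyz i (Finset.mem_univ i))
  exact (hs.mono interior_subset).null_res _

lemma hasLocalDimLE_of_complexChart (n : ℕ) [ChartedSpace (EuclideanSpace ℂ (Fin n)) X] :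
    HasLocalDimLE X (n + n) := by
  have hcoord (k : Fin n) : Continuous fun z : EuclideanSpace ℂ (Fin n) => z k :=
    (EuclideanSpace.proj (𝕜 := ℂ) k).continuous
  have hX : HasLocalDimLE X (Fintype.card (Fin n ⊕ Fin n)) :=
    hasLocalDimLE_of_chartedSpace (EuclideanSpace ℂ (Fin n))
      (f := Sum.elim (fun k z => (z k).re) fun k z => (z k).im)
      (Sum.rec (fun k => Complex.continuous_re.comp (hcoord k))
        fun k => Complex.continuous_im.comp (hcoord k))
      fun x y h => PiLp.ext fun k => Complex.ext (h (Sum.inl k)) (h (Sum.inr k))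
  rwa [Fintype.card_sum, Fintype.card_fin] at hX

end Compact

end MayerVietoris

section FiniteType

lemma height_le_of_surjective_mvPolynomial {k A : Type*} [Field k] [CommRing A] [Algebra k A]
    {n : ℕ} {f : MvPolynomial (Fin n) k →ₐ[k] A} (hf : Function.Surjective f) {p : Ideal A}
    (hp : p ≠ ⊤) : p.height ≤ n := by
  have hdim := ringKrullDim_le_of_surjective f.toRingHom hf
  rw [MvPolynomial.ringKrullDim_of_isNoetherianRing, ringKrullDim_eq_zero_of_field, zero_add,
    Nat.card_eq_fintype_card, Fintype.card_fin] at hdim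
  exact_mod_cast (Ideal.height_le_ringKrullDim_of_ne_top hp).trans hdim

variable (k : Type) [Field k] {S : Scheme.{0}} (f : S ⟶ Spec (CommRingCat.of k))

lemma exists_coheight_le_of_isAffineOpen [LocallyOfFiniteType f] {U : S.Opens}
    (hU : IsAffineOpen U) : ∃ n : ℕ, ∀ x ∈ U, Order.coheight x ≤ n := by
  have hΓ : (f.appLE ⊤ U le_top).hom.FiniteType :=
    f.finiteType_appLE (isAffineOpen_top _) hU le_top
  have hk := hΓ.comp (RingHom.FiniteType.of_surjective
    (Scheme.ΓSpecIso (CommRingCat.of k)).inv.hom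
    (Scheme.ΓSpecIso (CommRingCat.of k)).commRingCatIsoToRingEquiv.symm.surjective)
  algebraize [(f.appLE ⊤ U le_top).hom.comp (Scheme.ΓSpecIso (CommRingCat.of k)).inv.hom]
  obtain ⟨n, g, hg⟩ := Algebra.FiniteType.iff_quotient_mvPolynomial''.1 ‹_›
  refine ⟨n, fun x hx => ?_⟩
  obtain ⟨p, rfl⟩ : x ∈ Set.range hU.fromSpec := hU.range_fromSpec ▸ hx
  rw [coheight_eq_of_isOpenImmersion, ← idealHeight_eq_coheight]
  exact height_le_of_surjective_mvPolynomial hg p.2.ne_top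

lemma exists_coheight_le_of_locallyOfFiniteType [LocallyOfFiniteType f] [CompactSpace S] :
    ∃ d : ℕ, ∀ x : S, Order.coheight x ≤ d := by
  let 𝒰 := S.affineCover.finiteSubcover
  choose n hn using fun i => exists_coheight_le_of_isAffineOpen k f
    (have : IsAffine (𝒰.X i) := by dsimp [𝒰]; infer_instance
     isAffineOpen_opensRange (𝒰.f i))
  refine ⟨Finset.univ.sup n, fun x => ?_⟩
  obtain ⟨i, hi⟩ := 𝒰.exists_eq x
  exact (hn i x hi).trans (by exact_mod_cast Finset.le_sup (Finset.mem_univ i))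

lemma exists_hasLocalDimLE_of_locallyOfFiniteType [LocallyOfFiniteType f] [QuasiCompact f] :
    ∃ d : ℕ, HasLocalDimLE S d := by
  have : CompactSpace S := QuasiCompact.compactSpace_of_compactSpace f
  have : IsLocallyNoetherian S := LocallyOfFiniteType.isLocallyNoetherian f
  have : IsNoetherian S := {}
  obtain ⟨d, hd⟩ := exists_coheight_le_of_locallyOfFiniteType k f
  have hfinite (x : S) : Order.coheight x < ⊤ := (hd x).trans_lt (ENat.natCast_lt_top d)
  refine ⟨d, hasLocalDimLE_of_noetherianSpace (codim := fun x => (Order.coheight x).toNat)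
    (fun x y hyx hne => ?_) fun x => ENat.toNat_le_of_le_natCast (hd x)⟩
  have hxy : x < y := lt_of_le_not_ge hyx fun hxy => hne (hyx.antisymm hxy).eq
  have hlt := Order.coheight_strictAnti hxy (hfinite y)
  rwa [← ENat.natCast_toNat (hfinite x).ne, ← ENat.natCast_toNat (hfinite y).ne,
    Nat.cast_lt] at hlt

end FiniteType

lemma SmoothComplexVariety.exists_hasLocalDimLE (X : SmoothComplexVariety) :
    ∃ d : ℕ, HasLocalDimLE X.toCAlgSpace.space d := by
  cases X with
  | algebraic S f => exact exists_hasLocalDimLE_of_locallyOfFiniteType ℂ f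
  | analytic n M => exact ⟨n + n, hasLocalDimLE_of_complexChart (X := M) n⟩

lemma map_homOfLE_comp_assoc {C α : Type*} [Category* C] [Preorder α] (P : α ⥤ C)
    {U V W : α} (h : U ≤ V) (h' : V ≤ W) {Z : C} (f : P.obj W ⟶ Z) :
    P.map (homOfLE h) ≫ P.map (homOfLE h') ≫ f = P.map (homOfLE (h.trans h')) ≫ f := by
  rw [← Category.assoc, ← Functor.map_comp, homOfLE_comp]

section Coboundaries

variable {C : Type*} [Category* C] [Abelian C]

/-- A generalized element `φ` of the term of degree `j` of a complex is the image under the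
differential of a generalized element on the same source. -/
def IsCoboundary {K : CochainComplex C ℤ} {P : C} {j : ℤ} (φ : P ⟶ K.X j) : Prop :=
  ∃ t : P ⟶ K.X (j - 1), t ≫ K.d (j - 1) j = φ

lemma isCoboundary_iff {K : CochainComplex C ℤ} {P : C} {i j : ℤ} (hi : i + 1 = j)
    {φ : P ⟶ K.X j} : IsCoboundary φ ↔ ∃ t : P ⟶ K.X i, t ≫ K.d i j = φ := by
  obtain rfl : i = j - 1 := by omega
  rfl

lemma IsCoboundary.precomp {K : CochainComplex C ℤ} {P Q : C} {j : ℤ} {φ : P ⟶ K.X j}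
    (hφ : IsCoboundary φ) (g : Q ⟶ P) : IsCoboundary (g ≫ φ) :=
  let ⟨t, ht⟩ := hφ
  ⟨g ≫ t, by rw [Category.assoc, ht]⟩

variable {I : CochainComplex C ℤ}

lemma isCoboundary_of_shortExact [I.IsKInjective] {S₀ S₁ S₂ : ShortComplex C} (hS₀ : S₀.ShortExact)
    (f : S₀ ⟶ S₁) (g : S₁ ⟶ S₂) {i j : ℤ} (hi : i + 1 = j)
    (h₂ : ∀ ψ : S₂.X₂ ⟶ I.X j, ψ ≫ I.d j (j + 1) = 0 → IsCoboundary (g.τ₂ ≫ ψ))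
    (h₁ : ∀ χ : S₁.X₁ ⟶ I.X i, χ ≫ I.d i (i + 1) = 0 → IsCoboundary (f.τ₁ ≫ χ))
    (φ : S₂.X₃ ⟶ I.X j) (hφ : φ ≫ I.d j (j + 1) = 0) :
    IsCoboundary ((f ≫ g).τ₃ ≫ φ) := by
  subst hi
  obtain ⟨ψ, hψ⟩ := (isCoboundary_iff rfl).1 
    (h₂ (S₂.g ≫ φ) (by rw [Category.assoc, hφ, comp_zero]))
  obtain ⟨χ, hχ⟩ := h₁ (S₁.f ≫ ψ) (by
    rw [Category.assoc, hψ, g.comm₂₃_assoc, ← Category.assoc, S₁.zero, zero_comp])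
  refine (isCoboundary_iff rfl).2 (exists_comp_d_eq hS₀ (sub_add_cancel i 1) rfl rfl _
    (f.τ₂ ≫ ψ) χ ?_ ?_ ?_)
  · rw [Category.assoc, hφ, comp_zero]
  · rw [Category.assoc, hψ, g.comm₂₃_assoc, f.comm₂₃_assoc, ShortComplex.comp_τ₃, Category.assoc]
  · rw [hχ, f.comm₁₂_assoc]

variable {α : Type*} [Lattice α] (P : α ⥤ C)

lemma IsCoboundary.map_of_le {j : ℤ} {U V W : α} {φ : P.obj W ⟶ I.X j} {h : V ≤ W}
    (hφ : IsCoboundary (P.map (homOfLE h) ≫ φ)) (h' : U ≤ V) :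
    IsCoboundary (P.map (homOfLE (h'.trans h)) ≫ φ) := by
  rw [← map_homOfLE_comp_assoc P h' h]
  exact hφ.precomp _

lemma exists_mayerVietoris_obstruction [I.IsKInjective]
    (hP : ∀ V W : α, IsPushout (P.map (homOfLE (inf_le_left : V ⊓ W ≤ V)))
      (P.map (homOfLE (inf_le_right : V ⊓ W ≤ W))) (P.map (homOfLE (le_sup_left : V ≤ V ⊔ W)))
      (P.map (homOfLE (le_sup_right : W ≤ V ⊔ W))))
    [∀ {V W : α} (h : V ⟶ W), Mono (P.map h)] {j : ℤ} {W W₁ W₂ : α} (φ : P.obj W ⟶ I.X (j + 1))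
    (hφ : φ ≫ I.d (j + 1) (j + 1 + 1) = 0) (h₁ : W₁ ≤ W) (h₂ : W₂ ≤ W)
    (hφ₁ : IsCoboundary (P.map (homOfLE h₁) ≫ φ)) (hφ₂ : IsCoboundary (P.map (homOfLE h₂) ≫ φ)) :
    ∃ υ : P.obj (W₁ ⊓ W₂) ⟶ I.X j, υ ≫ I.d j (j + 1) = 0 ∧
      ∀ (V₁ V₂ : α) (hV₁ : V₁ ≤ W₁) (hV₂ : V₂ ≤ W₂),
        IsCoboundary (P.map (homOfLE (inf_le_inf hV₁ hV₂)) ≫ υ) →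
          IsCoboundary (P.map (homOfLE (sup_le (hV₁.trans h₁) (hV₂.trans h₂))) ≫ φ) := by
  obtain ⟨t₁, ht₁⟩ := (isCoboundary_iff rfl).1 hφ₁
  obtain ⟨t₂, ht₂⟩ := (isCoboundary_iff rfl).1 hφ₂
  refine ⟨P.map (homOfLE inf_le_left) ≫ t₁ - P.map (homOfLE inf_le_right) ≫ t₂, ?_, ?_⟩
  · simp only [Preadditive.sub_comp, Category.assoc, ht₁, ht₂, map_homOfLE_comp_assoc, sub_self]
  · rintro V₁ V₂ hV₁ hV₂ ⟨χ, hχ⟩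
    refine (isCoboundary_iff rfl).2 (exists_comp_d_eq_of_isPushout (hP V₁ V₂)
      (sub_add_cancel j 1) rfl rfl
      (P.map (homOfLE (sup_le (hV₁.trans h₁) (hV₂.trans h₂))) ≫ φ) (P.map (homOfLE hV₁) ≫ t₁)
      (P.map (homOfLE hV₂) ≫ t₂) χ ?_ ?_ ?_ ?_)
    · rw [Category.assoc, hφ, comp_zero]
    · rw [Category.assoc, ht₁, map_homOfLE_comp_assoc, map_homOfLE_comp_assoc]
    · rw [Category.assoc, ht₂, map_homOfLE_comp_assoc, map_homOfLE_comp_assoc]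
    · simp only [hχ, Preadditive.comp_sub, map_homOfLE_comp_assoc]

end Coboundaries

section Telescope

variable {R : Type*} [CommRing R] (r : R)

/-- The endomorphism `eₙ ↦ eₙ - r eₙ₊₁`, whose cokernel is the localization of `R` away from `r`. -/
def telescope : (ℕ →₀ R) →ₗ[R] (ℕ →₀ R) :=
  LinearMap.id - r • Finsupp.lmapDomain R R Nat.succ

lemma telescope_apply_zero (x : ℕ →₀ R) : telescope r x 0 = x 0 := by
  simp only [telescope, LinearMap.sub_apply, LinearMap.id_apply, LinearMap.smul_apply,
    Finsupp.lmapDomain_apply, Finsupp.sub_apply, Finsupp.smul_apply]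
  rw [Finsupp.mapDomain_of_notMem_range _ _ (by simp), smul_zero, sub_zero]

lemma telescope_apply_succ (x : ℕ →₀ R) (n : ℕ) :
    telescope r x (n + 1) = x (n + 1) - r * x n := by
  simp only [telescope, LinearMap.sub_apply, LinearMap.id_apply, LinearMap.smul_apply,
    Finsupp.lmapDomain_apply, Finsupp.sub_apply, Finsupp.smul_apply, smul_eq_mul]
  rw [← Nat.succ_eq_add_one, Finsupp.mapDomain_apply Nat.succ_injective]

lemma telescope_single (n : ℕ) (a : R) :
    telescope r (Finsupp.single n a) = Finsupp.single n a - Finsupp.single (n + 1) (r * a) := by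
  simp [telescope]

lemma telescope_injective : Function.Injective (telescope r) := by
  rw [injective_iff_map_eq_zero]
  intro x hx
  ext n
  induction n with
  | zero => rw [← telescope_apply_zero r x, hx]
  | succ n ih =>
    have h := telescope_apply_succ r x n
    rw [hx, ih] at h
    simpa using h.symm

lemma single_sub_single_mem_range (n m : ℕ) (a : R) :
    Finsupp.single n a - Finsupp.single (n + m) (r ^ m * a) ∈ LinearMap.range (telescope r) := by
  induction m with
  | zero => simp
  | succ m ih =>
    have h := add_mem ih (⟨_, telescope_single r (n + m) (r ^ m * a)⟩ :
      _ ∈ LinearMap.range (telescope r))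
    rwa [sub_add_sub_cancel, ← mul_assoc, ← pow_succ', add_assoc] at h

lemma exists_sub_single_mem_range (x : ℕ →₀ R) :
    ∃ (n : ℕ) (a : R), x - Finsupp.single n a ∈ LinearMap.range (telescope r) := by
  induction x using Finsupp.induction_linear with
  | zero => exact ⟨0, 0, by simp⟩
  | single n a => exact ⟨n, a, by simp⟩
  | add x y hx hy =>
    obtain ⟨n, a, hx⟩ := hx
    obtain ⟨m, b, hy⟩ := hy
    refine ⟨n + m, r ^ m * a + r ^ n * b, ?_⟩
    have h₁ := add_mem hx (single_sub_single_mem_range r n m a)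
    have h₂ := add_mem hy (single_sub_single_mem_range r m n b)
    rw [sub_add_sub_cancel] at h₁ h₂
    have h := add_mem h₁ h₂
    rw [add_comm m n] at h
    rwa [Finsupp.single_add, add_sub_add_comm]

variable (L : Type*) [CommRing L] [Algebra R L] [IsLocalization.Away r L]

/-- The augmentation `eₙ ↦ r⁻ⁿ` of the telescope. -/
def telescopeAug : (ℕ →₀ R) →ₗ[R] L :=
  Finsupp.linearCombination R fun n => IsLocalization.Away.invSelf (S := L) r ^ n

lemma telescopeAug_single (n : ℕ) (a : R) : telescopeAug r L (Finsupp.single n a) =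
    algebraMap R L a * IsLocalization.Away.invSelf (S := L) r ^ n := by
  rw [telescopeAug, Finsupp.linearCombination_single, Algebra.smul_def]

lemma pow_mul_telescopeAug_single (n : ℕ) (a : R) :
    algebraMap R L r ^ n * telescopeAug r L (Finsupp.single n a) = algebraMap R L a := by
  rw [telescopeAug_single, mul_left_comm, ← mul_pow, IsLocalization.Away.mul_invSelf, one_pow,
    mul_one]

lemma telescopeAug_comp_telescope : telescopeAug r L ∘ₗ telescope r = 0 := by
  refine Finsupp.lhom_ext fun n a => ?_
  rw [LinearMap.comp_apply, telescope_single, map_sub, telescopeAug_single, telescopeAug_single,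
    map_mul, pow_succ', mul_comm (algebraMap R L r), mul_assoc, ← mul_assoc (algebraMap R L r),
    IsLocalization.Away.mul_invSelf, one_mul, sub_self, LinearMap.zero_apply]

lemma telescope_exact : Function.Exact (telescope r) (telescopeAug r L) := by
  refine fun x => ⟨fun hx => ?_, ?_⟩
  · obtain ⟨n, a, h⟩ := exists_sub_single_mem_range r x
    have ha : algebraMap R L a = algebraMap R L 0 := by
      have h_aug : telescopeAug r L (x - Finsupp.single n a) = 0 := by
        obtain ⟨y, hy⟩ := h
        rw [← hy]
        exact LinearMap.congr_fun (telescopeAug_comp_telescope r L) y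
      rw [map_sub, hx, zero_sub, neg_eq_zero] at h_aug
      rw [← pow_mul_telescopeAug_single r L n a, h_aug, mul_zero, map_zero]
    obtain ⟨⟨_, m, rfl⟩, hm⟩ := (IsLocalization.eq_iff_exists (Submonoid.powers r) L).1 ha
    have h' := add_mem h (single_sub_single_mem_range r n m a)
    have hm' : r ^ m * a = 0 := by simpa using hm
    rwa [sub_add_sub_cancel, hm', Finsupp.single_zero, sub_zero] at h'
  · rintro ⟨y, rfl⟩
    exact LinearMap.congr_fun (telescopeAug_comp_telescope r L) y

lemma telescopeAug_surjective : Function.Surjective (telescopeAug r L) := by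
  intro l
  obtain ⟨n, a, h⟩ := IsLocalization.Away.surj r l
  refine ⟨Finsupp.single n a, ?_⟩
  rw [telescopeAug_single, ← h, mul_assoc, ← mul_pow, IsLocalization.Away.mul_invSelf, one_pow,
    mul_one]

end Telescope

/-- The resolution `0 ⟶ ⨁ R ⟶ ⨁ R ⟶ R[r⁻¹] ⟶ 0`. -/
def telescopeComplex {R : Type} [CommRing R] (r : R) (L : Type) [CommRing L] [Algebra R L]
    [IsLocalization.Away r L] : ShortComplex (ModuleCat.{0} R) :=
  ShortComplex.moduleCatMk (telescope r) (telescopeAug r L) (telescopeAug_comp_telescope r L)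

lemma shortExact_telescopeComplex {R : Type} [CommRing R] (r : R) (L : Type) [CommRing L]
    [Algebra R L] [IsLocalization.Away r L] : (telescopeComplex r L).ShortExact where
  exact := (ShortComplex.ShortExact.moduleCat_exact_iff_function_exact _).2 (telescope_exact r L)
  mono_f := (ModuleCat.mono_iff_injective _).2 (telescope_injective r)
  epi_g := (ModuleCat.epi_iff_surjective _).2 (telescopeAug_surjective r L)

namespace Algebroid

variable {R : Type} [CommRing R] {X : TopCat.{0}} (A : Algebroid R X)

section Total

variable {A} {c d e : A.Total}

lemma homMk_injective (i : c.base ⟶ d.base) :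
    Function.Injective (A.homMk (c := c) (d := d) i) := by
  intro a b h
  injection h

lemma exists_linear_postcomp (f : c ⟶ d) (i : d.base ⟶ e.base) :
    ∃ K : ((A.F.map i.toLoc).toFunctor.obj d.fiber ⟶ e.fiber) →ₗ[R]
        ((A.F.map (f.base ≫ i).toLoc).toFunctor.obj c.fiber ⟶ e.fiber),
      ∀ a, f ≫ A.homMk i a = A.homMk (f.base ≫ i) (K a) :=
  ⟨Linear.leftComp R _ ((A.F.mapComp f.base.toLoc i.toLoc).hom.toNatTrans.app c.fiber ≫
      (A.F.map i.toLoc).toFunctor.map f.fiber), fun _ =>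
    congrArg (A.homMk (f.base ≫ i)) (Category.assoc _ _ _).symm⟩

instance {V : Opens X} (i : V ⟶ c.base.unop) : Epi (A.toRestrict c i) where
  left_cancellation {e} g h hgh := by
    obtain ⟨j, a⟩ := g
    obtain ⟨j', b⟩ := h
    obtain rfl : j = j' := Subsingleton.elim _ _
    let γ := (A.F.mapComp i.op.toLoc j.toLoc).hom.toNatTrans.app c.fiber
    have : IsIso γ := by infer_instance
    have h : γ ≫ (A.F.map j.toLoc).toFunctor.map (𝟙 _) ≫ a =
      γ ≫ (A.F.map j.toLoc).toFunctor.map (𝟙 _) ≫ b := homMk_injective _ hgh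
    rw [cancel_epi] at h
    erw [CategoryTheory.Functor.map_id, Category.id_comp, Category.id_comp] at h
    exact congrArg (A.homMk (c := A.restrict c i) j) h

variable (A c) in
/-- The morphism `(V, σ|_V) ⟶ (W, σ|_W)` for `W ⊆ V`. -/
def resHom {V W : Opens X} (hV : V ≤ c.base.unop) (h : W ≤ V) :
    A.restrict c (homOfLE hV) ⟶ A.restrict c (homOfLE (h.trans hV)) :=
  (A.exists_fac (e := A.restrict c (homOfLE (h.trans hV))) (homOfLE hV) (homOfLE h)
    (A.toRestrict c _)).choose

@[simp]
lemma toRestrict_resHom {V W : Opens X} (hV : V ≤ c.base.unop) (h : W ≤ V) :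
    A.toRestrict c (homOfLE hV) ≫ A.resHom c hV h = A.toRestrict c (homOfLE (h.trans hV)) :=
  (A.exists_fac (e := A.restrict c (homOfLE (h.trans hV))) (homOfLE hV) (homOfLE h)
    (A.toRestrict c _)).choose_spec

@[simp]
lemma resHom_comp_resHom {V W Z : Opens X} (hV : V ≤ c.base.unop) (h : W ≤ V) (h' : Z ≤ W) :
    A.resHom c hV h ≫ A.resHom c (h.trans hV) h' = A.resHom c hV (h'.trans h) :=
  (cancel_epi (A.toRestrict c (homOfLE hV))).1 (by
    rw [← Category.assoc, toRestrict_resHom, toRestrict_resHom, toRestrict_resHom])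

variable (A c) in
/-- The restrictions of `(U, σ)` to the open subsets of `U`. -/
def restrictions : Set.Iic c.base.unop ⥤ A.Site where
  obj V := op (A.restrict c (homOfLE (Set.mem_Iic.1 V.2)))
  map h := (A.resHom c _ (leOfHom h)).op
  map_id V := Quiver.Hom.unop_inj ((cancel_epi (A.toRestrict c (homOfLE (Set.mem_Iic.1 V.2)))).1
    ((toRestrict_resHom V.2 le_rfl).trans (Category.comp_id _).symm))
  map_comp g h := Quiver.Hom.unop_inj (resHom_comp_resHom _ (leOfHom h) (leOfHom g)).symm

lemma exists_homMk_comp_toRestrict (i : c.base ⟶ d.base) {V : Opens X} (v : V ⟶ c.base.unop) :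
    ∃ (b : (A.restrict c v).base ⟶ (A.restrict d
        (homOfLE (inf_le_right : V ⊓ d.base.unop ≤ d.base.unop))).base)
      (K : ((A.F.map i.toLoc).toFunctor.obj c.fiber ⟶ d.fiber) →ₗ[R]
        ((A.F.map b.toLoc).toFunctor.obj (A.restrict c v).fiber ⟶ (A.restrict d
          (homOfLE (inf_le_right : V ⊓ d.base.unop ≤ d.base.unop))).fiber)),
      ∀ a, A.homMk i a ≫ A.toRestrict d (homOfLE inf_le_right) =
        A.toRestrict c v ≫ A.homMk b (K a) := by
  obtain ⟨K₁, hK₁⟩ := A.exists_linear_comp i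
    (A.toRestrict d (homOfLE (inf_le_right : V ⊓ d.base.unop ≤ d.base.unop)))
  obtain ⟨K₂, hK₂⟩ := A.exists_linear_fac (e := A.restrict d (homOfLE inf_le_right)) v
    (homOfLE inf_le_left) _
  exact ⟨_, K₂ ∘ₗ K₁, fun a => (hK₁ a).trans (hK₂ _).symm⟩

end Total

section HomModule

variable {c d e : A.Total}

lemma ι_injective (i : c.base ⟶ d.base) : Function.Injective (A.ι (d := d) i) := by
  classical
  exact DirectSum.of_injective (β := fun i : c.base ⟶ d.base =>
    ((A.F.map i.toLoc).toFunctor.obj c.fiber ⟶ d.fiber)) i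

lemma single_surjective (i : c.base ⟶ d.base) :
    Function.Surjective (A.single (c := c) (d := d)) := by
  have h : (LinearMap.range (A.ι (d := d) i)).mkQ = 0 := A.homModule_ext fun f => by
    obtain rfl : f.base = i := Subsingleton.elim _ _
    exact (Submodule.Quotient.mk_eq_zero _).2 ⟨f.fiber, rfl⟩
  intro x
  obtain ⟨a, rfl⟩ := (Submodule.Quotient.mk_eq_zero _).1 (LinearMap.congr_fun h x)
  exact ⟨A.homMk i a, rfl⟩

lemma single_injective : Function.Injective (A.single (c := c) (d := d)) := by
  rintro ⟨i, a⟩ ⟨i', b⟩ h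
  obtain rfl : i = i' := Subsingleton.elim _ _
  exact congrArg (A.homMk i) (A.ι_injective i h)

lemma precomp_injective (g : c ⟶ d) [Epi g] (e : A.Total) :
    Function.Injective (A.precomp g e) := by
  rcases isEmpty_or_nonempty (d.base ⟶ e.base) with hd | ⟨⟨i⟩⟩
  · have h : (LinearMap.id : A.homModule d e →ₗ[R] _) = 0 :=
      A.homModule_ext fun f => hd.elim f.base
    exact fun x y _ => (LinearMap.congr_fun h x).trans (LinearMap.congr_fun h y).symm
  · intro x y hxy
    obtain ⟨f, rfl⟩ := A.single_surjective i x
    obtain ⟨f', rfl⟩ := A.single_surjective i y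
    rw [precomp_single, precomp_single] at hxy
    exact congrArg A.single ((cancel_epi g).1 (A.single_injective hxy))

lemma postcomp_homMk_add (c : A.Total) (i : d.base ⟶ e.base)
    (a b : (A.F.map i.toLoc).toFunctor.obj d.fiber ⟶ e.fiber) :
    A.postcomp c (A.homMk i (a + b)) = A.postcomp c (A.homMk i a) + A.postcomp c (A.homMk i b) := by
  refine A.homModule_ext fun f => ?_
  obtain ⟨K, hK⟩ := exists_linear_postcomp f i
  simp only [LinearMap.add_apply, postcomp_single, hK, map_add]
  exact map_add (A.ι _) _ _

lemma postcomp_homMk_smul (c : A.Total) (i : d.base ⟶ e.base) (r : R)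
    (a : (A.F.map i.toLoc).toFunctor.obj d.fiber ⟶ e.fiber) :
    A.postcomp c (A.homMk i (r • a)) = r • A.postcomp c (A.homMk i a) := by
  refine A.homModule_ext fun f => ?_
  obtain ⟨K, hK⟩ := exists_linear_postcomp f i
  simp only [LinearMap.smul_apply, postcomp_single, hK, map_smul]
  exact map_smul (A.ι _) _ _

end HomModule

lemma isLinear_tensorBimodule (L : ModuleCat.{0} R) (c : A.Site) :
    A.IsLinear ((A.tensorBimodule L).obj c) where
  map_add {d e} i a b := A.tensorBimodule_ext L fun l f => by
    change TensorProduct.tmul R l (A.postcomp c.unop (A.homMk i (a + b)) (A.single f)) =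
      TensorProduct.tmul R l (A.postcomp c.unop (A.homMk i a) (A.single f)) +
      TensorProduct.tmul R l (A.postcomp c.unop (A.homMk i b) (A.single f))
    rw [postcomp_homMk_add, LinearMap.add_apply, TensorProduct.tmul_add]
  map_smul {d e} i r a := A.tensorBimodule_ext L fun l f => by
    change TensorProduct.tmul R l (A.postcomp c.unop (A.homMk i (r • a)) (A.single f)) =
      r • TensorProduct.tmul R l (A.postcomp c.unop (A.homMk i a) (A.single f))
    rw [postcomp_homMk_smul, LinearMap.smul_apply, TensorProduct.tmul_smul]

section LocallySurjective

variable {A} {M : A.Siteᵒᵖ ⥤ ModuleCat.{0} R} {N : Sheaf A.topology (ModuleCat.{0} R)}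

lemma exists_locally_map_homMk_eq (f : M ⟶ N.obj) [Presheaf.IsLocallySurjective A.topology f]
    {c d : A.Total} (i : c.base ⟶ d.base) (q : N.obj.obj (op (op c))) (x : X)
    (hx : x ∈ d.base.unop) : ∃ (W : Opens X) (j : W ⟶ d.base.unop) (e : A.Total)
      (b : e.base ⟶ (A.restrict d j).base)
      (K : ((A.F.map i.toLoc).toFunctor.obj c.fiber ⟶ d.fiber) →ₗ[R]
        ((A.F.map b.toLoc).toFunctor.obj e.fiber ⟶ (A.restrict d j).fiber))
      (m : M.obj (op (op e))), x ∈ W ∧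
      ∀ a, N.obj.map (A.toRestrict d j).op.op (N.obj.map (A.homMk i a).op.op q) =
        f.app _ (M.map (A.homMk b (K a)).op.op m) := by
  obtain ⟨V, v, hxV, m, hm⟩ := Presheaf.imageSieve_mem A.topology f q x (leOfHom i.unop hx)
  obtain ⟨b, K, hK⟩ := exists_homMk_comp_toRestrict (d := d) i v
  refine ⟨_, _, _, b, K, m, ⟨hxV, hx⟩, fun a => ?_⟩
  calc N.obj.map (A.toRestrict d _).op.op (N.obj.map (A.homMk i a).op.op q)
      = N.obj.map (A.homMk i a ≫ A.toRestrict d _).op.op q := by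
        rw [op_comp, op_comp, Functor.map_comp]; rfl
    _ = N.obj.map _ (N.obj.map (A.toRestrict c v).op.op q) := by
        rw [hK, op_comp, op_comp, Functor.map_comp]; rfl
    _ = N.obj.map _ (f.app _ m) := congrArg _ hm.symm
    _ = _ := (NatTrans.naturality_apply f _ m).symm

lemma IsLinear.of_isLocallySurjective (f : M ⟶ N.obj)
    [Presheaf.IsLocallySurjective A.topology f] (hM : A.IsLinear M) : A.IsLinear N.obj where
  map_add i a b := by
    ext q
    refine A.eq_of_locally_eq N _ _ fun x hx => ?_
    obtain ⟨W, j, e, b', K, m, hxW, hK⟩ := exists_locally_map_homMk_eq f i q x hx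
    exact ⟨W, j, hxW, by simp [hK, hM.map_add]⟩
  map_smul i r a := by
    ext q
    refine A.eq_of_locally_eq N _ _ fun x hx => ?_
    obtain ⟨W, j, e, b', K, m, hxW, hK⟩ := exists_locally_map_homMk_eq f i q x hx
    exact ⟨W, j, hxW, by simp [hK, hM.map_smul]⟩

lemma isModule_presheafToSheaf {P : A.Siteᵒᵖ ⥤ ModuleCat.{0} R} (hP : A.IsLinear P) :
    A.isModule ((presheafToSheaf A.topology _).obj P) :=
  have : Presheaf.IsLocallySurjective A.topology (toSheafify A.topology P) := inferInstance
  IsLinear.of_isLocallySurjective (N := (presheafToSheaf A.topology _).obj P)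
    (toSheafify A.topology P) hP

end LocallySurjective

/-- The sections `(U, σ) ↦ Γ(U; N(σ))`, as a functor in `(U, σ)` and `N`. -/
def ev : A.Total ⥤ A.Mod ⥤ ModuleCat.{0} R where
  obj c := A.isModule.ι ⋙ sheafToPresheaf _ _ ⋙ (evaluation _ _).obj (op (op c))
  map g := Functor.whiskerLeft _ (Functor.whiskerLeft _ ((evaluation _ _).map g.op.op))

instance (c : A.Total) : (A.ev.obj c).Additive where
  map_add := rfl

/-- The sheaves `L ⊗ 𝒜(σ, ·)` extended by zero from `U`, as a functor in `(U, σ)` and `L`. -/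
def freeSheaf : A.Site ⥤ ModuleCat.{0} R ⥤ Sheaf A.topology (ModuleCat.{0} R) :=
  A.bimodule ⋙ Functor.whiskeringLeft _ _ _ ⋙
    (Functor.whiskeringLeft _ _ _).obj (MonoidalCategory.curriedTensor (ModuleCat.{0} R)) ⋙
    (Functor.whiskeringRight _ _ _).obj (presheafToSheaf A.topology _)

/-- The modules `L ⊗ 𝒜(σ, ·)` extended by zero from `U`, as a functor in `(U, σ)` and `L`. -/
def free : A.Site ⥤ ModuleCat.{0} R ⥤ A.Mod where
  obj c := A.isModule.lift (A.freeSheaf.obj c)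
    fun L => isModule_presheafToSheaf (A.isLinear_tensorBimodule L c)
  map g :=
    { app L := ObjectProperty.homMk ((A.freeSheaf.map g).app L)
      naturality _ _ k := A.isModule.hom_ext ((A.freeSheaf.map g).naturality k) }
  map_id c := NatTrans.ext (funext fun L => A.isModule.hom_ext
    (congrArg (fun τ : A.freeSheaf.obj c ⟶ A.freeSheaf.obj c => τ.app L) (A.freeSheaf.map_id c)))
  map_comp f g := NatTrans.ext (funext fun L => A.isModule.hom_ext
    (NatTrans.congr_app (A.freeSheaf.map_comp f g) L))

section HomEquiv

variable {A} {c d : A.Site} {L L' : ModuleCat.{0} R} {M N : A.Mod}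

/-- The morphisms from `L ⊗ 𝒜(σ, ·)` to `N` are the sections over `(U, σ)` of
`ℋom_𝒜(L ⊗ 𝒜, N)`. -/
def freeHomModEquiv :
    ((A.free.obj c).obj L ⟶ N) ≃ (A.ev.obj c.unop).obj ((A.homMod L).obj N) :=
  ((A.isModule.fullyFaithfulι.homEquiv (X := (A.free.obj c).obj L)).trans
    ((sheafificationAdjunction A.topology (ModuleCat.{0} R)).homEquiv
      ((A.tensorBimodule L).obj c) N.obj) :)

lemma freeHomModEquiv_comp (f : (A.free.obj c).obj L ⟶ M) (g : M ⟶ N) :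
    freeHomModEquiv (f ≫ g) =
      (A.ev.obj c.unop).map ((A.homMod L).map g) (freeHomModEquiv f) :=
  (sheafificationAdjunction A.topology (ModuleCat.{0} R)).homEquiv_naturality_right f.hom g.hom

lemma freeHomModEquiv_free_map (g : c ⟶ d) (f : (A.free.obj d).obj L ⟶ N) :
    freeHomModEquiv ((A.free.map g).app L ≫ f) =
      (A.ev.map g.unop).app ((A.homMod L).obj N) (freeHomModEquiv f) :=
  (sheafificationAdjunction A.topology (ModuleCat.{0} R)).homEquiv_naturality_left
    ((A.tensorBimodule L).map g) f.hom

/-- The morphisms from `L ⊗ 𝒜(σ, ·)` to `N` are the `R`-linear maps from `L` to the sections of `N`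
over `(U, σ)`. -/
def freeHomEquiv : ((A.free.obj c).obj L ⟶ N) ≃ (L ⟶ (A.ev.obj c.unop).obj N) :=
  have := isIso_evalAtUnit L N.property
  freeHomModEquiv.trans (asIso ((A.evalAtUnit L N.obj.obj).app (op c))).toLinearEquiv.toEquiv

lemma freeHomEquiv_comp (f : (A.free.obj c).obj L ⟶ M) (g : M ⟶ N) :
    freeHomEquiv (f ≫ g) = freeHomEquiv f ≫ (A.ev.obj c.unop).map g :=
  congrArg (fun t => (A.evalAtUnit L N.obj.obj).app (op c) t) (freeHomModEquiv_comp f g)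

lemma freeHomEquiv_free_map (g : c ⟶ d) (f : (A.free.obj d).obj L ⟶ N) :
    freeHomEquiv ((A.free.map g).app L ≫ f) = freeHomEquiv f ≫ (A.ev.map g.unop).app N :=
  (congrArg (fun t => (A.evalAtUnit L N.obj.obj).app (op c) t) (freeHomModEquiv_free_map g f)).trans
    (NatTrans.naturality_apply (A.evalAtUnit L N.obj.obj) g.op (freeHomModEquiv f))

lemma freeHomEquiv_free_obj_map (k : L' ⟶ L) (f : (A.free.obj c).obj L ⟶ N) :
    freeHomEquiv ((A.free.obj c).map k ≫ f) = k ≫ freeHomEquiv f :=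
  congrArg (fun t => A.unitMap L' (op c) ≫ NatTrans.app t (op c))
    ((sheafificationAdjunction A.topology (ModuleCat.{0} R)).homEquiv_naturality_left
      (Functor.whiskerLeft (A.bimodule.obj c) ((MonoidalCategory.curriedTensor _).map k)) f.hom)

/-- The functor `L ↦ L ⊗ 𝒜(σ, ·)` is left adjoint to the sections over `(U, σ)`. -/
def freeAdjunction (c : A.Site) : A.free.obj c ⊣ A.ev.obj c.unop :=
  Adjunction.mkOfHomEquiv
    { homEquiv _ _ := freeHomEquiv
      homEquiv_naturality_left_symm k n := freeHomEquiv.injective (by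
        rw [freeHomEquiv_free_obj_map, Equiv.apply_symm_apply, Equiv.apply_symm_apply])
      homEquiv_naturality_right := freeHomEquiv_comp }

instance (c : A.Site) : (A.free.obj c).IsLeftAdjoint := ⟨_, ⟨freeAdjunction c⟩⟩

instance (c : A.Site) : (A.free.obj c).Additive := (freeAdjunction c).left_adjoint_additive

end HomEquiv

variable {A}

instance : (presheafToSheaf A.topology (ModuleCat.{0} R)).PreservesMonomorphisms :=
  have : PreservesFiniteLimits (presheafToSheaf A.topology (ModuleCat.{0} R)) := inferInstance
  inferInstance

instance {c d : A.Site} (g : c ⟶ d) [Epi g.unop] (L : ModuleCat.{0} R)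
    [Module.Flat R L] : Mono ((A.free.map g).app L) := by
  have h (e : A.Siteᵒᵖ) : Mono (((A.tensorBimodule L).map g).app e) :=
    (ModuleCat.mono_iff_injective _).2
      (Module.Flat.lTensor_preserves_injective_linearMap _ (A.precomp_injective g.unop e.unop.unop))
  have : Mono ((A.tensorBimodule L).map g) := NatTrans.mono_of_mono_app _
  exact A.isModule.ι.mono_of_mono_map
    (inferInstanceAs (Mono ((presheafToSheaf A.topology _).map ((A.tensorBimodule L).map g))))

lemma shortExact_map_free_obj (c : A.Site) {S : ShortComplex (ModuleCat.{0} R)}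
    (hS : S.ShortExact) [Module.Flat R S.X₃] : (S.map (A.free.obj c)).ShortExact := by
  let τ := Functor.whiskerLeft (A.bimodule.obj c)
    ((MonoidalCategory.curriedTensor (ModuleCat.{0} R)).map S.f)
  have hτ (e : A.Siteᵒᵖ) : Mono (τ.app e) := (ModuleCat.mono_iff_injective _).2
    ((LinearMap.lTensor_inj_iff_rTensor_inj _ _).1
      (LinearMap.lTensor_injective_of_exact_of_flat S.g.hom
        ((ModuleCat.epi_iff_surjective _).1 hS.epi_g) S.f.hom
        ((ModuleCat.mono_iff_injective _).1 hS.mono_f)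
        ((ShortComplex.ShortExact.moduleCat_exact_iff_function_exact S).1 hS.exact)
        (A.homModule c.unop e.unop.unop)))
  have : Mono τ := NatTrans.mono_of_mono_app _
  have := hS.epi_g
  exact
    { exact := hS.exact.map_of_epi_of_preservesCokernel _ inferInstance inferInstance
      mono_f := A.isModule.ι.mono_of_mono_map
        (inferInstanceAs (Mono ((presheafToSheaf A.topology _).map τ)))
      epi_g := inferInstanceAs (Epi ((A.free.obj c).map S.g)) }

section LocalExactness

variable {c : A.Total} {M N : A.Mod}

lemma epi_of_locally_surjective (f : M ⟶ N)
    (h : ∀ (c : A.Total) (n : (A.ev.obj c).obj N), ∀ x ∈ c.base.unop,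
      ∃ (V : Opens X) (i : V ⟶ c.base.unop) (m : (A.ev.obj (A.restrict c i)).obj M), x ∈ V ∧
        (A.ev.obj _).map f m = (A.ev.map (A.toRestrict c i)).app N n) : Epi f where
  left_cancellation {Z} a b hab := by
    refine A.isModule.hom_ext (ObjectProperty.hom_ext _ (NatTrans.ext (funext fun c => ?_)))
    ext n
    refine A.eq_of_locally_eq Z.obj (d := c.unop.unop) _ _ fun x hx => ?_
    obtain ⟨V, i, m, hxV, hm⟩ := h c.unop.unop n x hx
    have natural (k : N ⟶ Z) : (A.ev.map (A.toRestrict c.unop.unop i)).app Z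
        ((A.ev.obj c.unop.unop).map k n) = (A.ev.obj _).map k ((A.ev.obj _).map f m) :=
      (NatTrans.naturality_apply (A.ev.map (A.toRestrict c.unop.unop i)) k n).trans
        (congrArg _ hm.symm)
    exact ⟨V, i, hxV, (natural a).trans ((congrArg (fun k => (A.ev.obj _).map k m) hab).trans
      (natural b).symm)⟩

lemma exact_of_locally_exact (S : ShortComplex A.Mod)
    (h : ∀ (c : A.Total) (s : (A.ev.obj c).obj S.X₂), (A.ev.obj c).map S.g s = 0 →
      ∀ x ∈ c.base.unop, ∃ (V : Opens X) (i : V ⟶ c.base.unop)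
        (t : (A.ev.obj (A.restrict c i)).obj S.X₁), x ∈ V ∧
        (A.ev.obj _).map S.f t = (A.ev.map (A.toRestrict c i)).app S.X₂ s) : S.Exact := by
  rw [S.exact_iff_epi_kernel_lift]
  refine epi_of_locally_surjective _ fun c k x hx => ?_
  obtain ⟨V, i, t, hxV, ht⟩ := h c ((A.ev.obj c).map (kernel.ι S.g) k) (by
    rw [← ModuleCat.comp_apply, ← Functor.map_comp, kernel.condition, Functor.map_zero]; rfl) x hx
  have : (A.ev.obj (A.restrict c i)).PreservesMonomorphisms :=
    Functor.preservesMonomorphisms_of_adjunction (freeAdjunction (op (A.restrict c i)))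
  refine ⟨V, i, t, hxV, (ModuleCat.mono_iff_injective
    ((A.ev.obj (A.restrict c i)).map (kernel.ι S.g))).1 inferInstance ?_⟩
  rw [← ModuleCat.comp_apply, ← Functor.map_comp, kernel.lift_ι, ht]
  exact NatTrans.naturality_apply (A.ev.map (A.toRestrict c i)) (kernel.ι S.g) k

lemma exists_locally_lift (f : M ⟶ N) [Epi f]
    (n : (A.free.obj (op c)).obj (ModuleCat.of R R) ⟶ N) {x : X} (hx : x ∈ c.base.unop) :
    ∃ (V : Opens X) (i : V ⟶ c.base.unop)
      (m : (A.free.obj (op (A.restrict c i))).obj (ModuleCat.of R R) ⟶ M), x ∈ V ∧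
      m ≫ f = (A.free.map (A.toRestrict c i).op).app _ ≫ n := by
  have := A.isModule.preservesEpimorphisms_ι_of_isNormalMonoCategory
  have : Epi f.hom := inferInstanceAs (Epi (A.isModule.ι.map f))
  have := (Sheaf.isLocallySurjective_iff_epi' (J := A.topology) (A := ModuleCat.{0} R) f.hom).2
    inferInstance
  obtain ⟨V, i, hxV, m, hm⟩ :
      ∃ (V : Opens X) (i : V ⟶ c.base.unop), x ∈ V ∧ ∃ (m : (A.ev.obj (A.restrict c i)).obj M),
        (A.ev.obj _).map f m = (A.ev.map (A.toRestrict c i)).app N (freeHomEquiv n (1 : R)) :=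
    Presheaf.imageSieve_mem A.topology f.hom.hom (freeHomEquiv n (1 : R)) x hx
  let m' : ModuleCat.of R R ⟶ (A.ev.obj (A.restrict c i)).obj M :=
    ModuleCat.ofHom (LinearMap.toSpanSingleton R _ m)
  have hm' : m' ≫ (A.ev.obj _).map f = freeHomEquiv n ≫ (A.ev.map (A.toRestrict c i)).app N := by
    ext
    exact (congrArg ((A.ev.obj (A.restrict c i)).map f) (one_smul R m)).trans hm
  refine ⟨V, i, freeHomEquiv.symm m', hxV, freeHomEquiv.injective ?_⟩
  rw [freeHomEquiv_comp, freeHomEquiv_free_map]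
  exact (congrArg (fun k => k ≫ (A.ev.obj (A.restrict c i)).map f)
    (freeHomEquiv.apply_symm_apply m')).trans hm'

lemma exists_locally_lift_of_exact {S : ShortComplex A.Mod} (hS : S.Exact)
    (s : (A.free.obj (op c)).obj (ModuleCat.of R R) ⟶ S.X₂) (hs : s ≫ S.g = 0) {x : X}
    (hx : x ∈ c.base.unop) :
    ∃ (V : Opens X) (i : V ⟶ c.base.unop)
      (t : (A.free.obj (op (A.restrict c i))).obj (ModuleCat.of R R) ⟶ S.X₁), x ∈ V ∧
      t ≫ S.f = (A.free.map (A.toRestrict c i).op).app _ ≫ s := by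
  have : Epi (kernel.lift S.g S.f S.zero) := S.exact_iff_epi_kernel_lift.1 hS
  obtain ⟨V, i, t, hxV, ht⟩ :=
    exists_locally_lift (kernel.lift S.g S.f S.zero) (kernel.lift S.g s hs) hx
  refine ⟨V, i, t, hxV, ?_⟩
  rw [← kernel.lift_ι S.g S.f S.zero, ← Category.assoc, ht, Category.assoc, kernel.lift_ι]

end LocalExactness

section Restrictions

variable {c : A.Total}

instance {V W : Set.Iic c.base.unop} (h : V ⟶ W) : Mono ((A.restrictions c).map h) :=
  have : Epi (A.resHom c W.2 (leOfHom h)) := epi_of_epi_fac (toRestrict_resHom W.2 (leOfHom h))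
  op_mono_of_epi (A.resHom c W.2 (leOfHom h))

lemma exists_lift_restrictions {V W : Set.Iic c.base.unop} (h : W ≤ V) {e : A.Site}
    (g : e ⟶ (A.restrictions c).obj V) (he : e.unop.base.unop ≤ W.1) :
    ∃ k : e ⟶ (A.restrictions c).obj W, k ≫ (A.restrictions c).map (homOfLE h) = g := by
  let toV := A.toRestrict c (homOfLE (Set.mem_Iic.1 V.2))
  obtain ⟨k, hk⟩ := A.exists_fac (homOfLE W.2) (homOfLE he) (toV ≫ g.unop)
  refine ⟨k.op, Quiver.Hom.unop_inj ((cancel_epi toV).1 ?_)⟩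
  rw [← hk, ← toRestrict_resHom V.2 h, Category.assoc]
  rfl

end Restrictions

variable {c : A.Total}

lemma isPullback_restrictions (V W : Set.Iic c.base.unop) :
    IsPullback ((A.restrictions c).map (homOfLE (inf_le_left : V ⊓ W ≤ V)))
      ((A.restrictions c).map (homOfLE (inf_le_right : V ⊓ W ≤ W)))
      ((A.restrictions c).map (homOfLE (le_sup_left : V ≤ V ⊔ W)))
      ((A.restrictions c).map (homOfLE (le_sup_right : W ≤ V ⊔ W))) where
  w := by rw [← Functor.map_comp, ← Functor.map_comp]; rfl
  isLimit' := by
    have exists_lift (s : PullbackCone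
        ((A.restrictions c).map (homOfLE (le_sup_left : V ≤ V ⊔ W)))
        ((A.restrictions c).map (homOfLE (le_sup_right : W ≤ V ⊔ W)))) :=
      exists_lift_restrictions (inf_le_left : V ⊓ W ≤ V)
        s.fst (le_inf (leOfHom s.fst.unop.base.unop) (leOfHom s.snd.unop.base.unop))
    choose k hk using exists_lift
    have hk' s : k s ≫ (A.restrictions c).map (homOfLE (inf_le_right : V ⊓ W ≤ W)) = s.snd := by
      rw [← cancel_mono ((A.restrictions c).map (homOfLE (le_sup_right : W ≤ V ⊔ W))),
        ← s.condition, ← hk s, Category.assoc, Category.assoc, ← Functor.map_comp,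
        ← Functor.map_comp]
      rfl
    exact ⟨PullbackCone.isLimitAux' _ fun s => ⟨k s, hk s, hk' s, fun hm _ =>
      (cancel_mono ((A.restrictions c).map (homOfLE (inf_le_left : V ⊓ W ≤ V)))).1
        (hm.trans (hk s).symm)⟩⟩

lemma ofTwoArrows_restrictions_mem (V W : Set.Iic c.base.unop) :
    Sieve.ofTwoArrows ((A.restrictions c).map (homOfLE (le_sup_left : V ≤ V ⊔ W)))
      ((A.restrictions c).map (homOfLE (le_sup_right : W ≤ V ⊔ W))) ∈
      A.topology ((A.restrictions c).obj (V ⊔ W)) := by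
  rintro x (hx | hx)
  · obtain ⟨k, hk⟩ := exists_lift_restrictions (le_sup_left : V ≤ V ⊔ W)
      (A.toRestrict _ (homOfLE le_sup_left)).op le_rfl
    exact ⟨V.1, homOfLE le_sup_left, hx, _, k, _, .mk WalkingPair.left, hk⟩
  · obtain ⟨k, hk⟩ := exists_lift_restrictions (le_sup_right : W ≤ V ⊔ W)
      (A.toRestrict _ (homOfLE le_sup_right)).op le_rfl
    exact ⟨W.1, homOfLE le_sup_right, hx, _, k, _, .mk WalkingPair.right, hk⟩

variable (A c) in
/-- The square of the restrictions of `(U, σ)` to two open subsets of `U`, their intersection and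
their union. -/
def mayerVietorisSquare (V W : Set.Iic c.base.unop) : A.topology.MayerVietorisSquare :=
  let r := A.restrictions c
  have mono {V W : Set.Iic c.base.unop} (h : V ≤ W) : Mono (r.map (homOfLE h)) := inferInstance
  @GrothendieckTopology.MayerVietorisSquare.mk_of_isPullback _ _ _ _
    { f₁₂ := r.map (homOfLE (inf_le_left : V ⊓ W ≤ V))
      f₁₃ := r.map (homOfLE (inf_le_right : V ⊓ W ≤ W))
      f₂₄ := r.map (homOfLE (le_sup_left : V ≤ V ⊔ W))
      f₃₄ := r.map (homOfLE (le_sup_right : W ≤ V ⊔ W))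
      fac := (isPullback_restrictions V W).w }
    (mono le_sup_left) (mono le_sup_right) (isPullback_restrictions V W)
    (ofTwoArrows_restrictions_mem V W)

variable (A c) in
/-- The modules `L ⊗ 𝒜(σ|_V, ·)` extended by zero from `V`, as a functor in `V ⊆ U` and `L`. -/
abbrev freeOn : Set.Iic c.base.unop ⥤ ModuleCat.{0} R ⥤ A.Mod := A.restrictions c ⋙ A.free

lemma exists_lift_freeOn_of_exact {S : ShortComplex A.Mod} (hS : S.Exact)
    {V : Set.Iic c.base.unop} (s : ((A.freeOn c).obj V).obj (ModuleCat.of R R) ⟶ S.X₂)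
    (hs : s ≫ S.g = 0) {x : X} (hx : x ∈ V.1) :
    ∃ (W : Set.Iic c.base.unop) (h : W ≤ V)
      (t : ((A.freeOn c).obj W).obj (ModuleCat.of R R) ⟶ S.X₁), x ∈ W.1 ∧
      t ≫ S.f = ((A.freeOn c).map (homOfLE h)).app _ ≫ s := by
  obtain ⟨W, i, t, hxW, ht⟩ := exists_locally_lift_of_exact hS s hs hx
  let W' : Set.Iic c.base.unop := ⟨W, (leOfHom i).trans V.2⟩
  have h : W' ≤ V := leOfHom i
  obtain ⟨k, hk⟩ := A.exists_fac i (𝟙 W) ((A.restrictions c).map (homOfLE h)).unop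
  have hk' : (A.free.map k.op).app (ModuleCat.of R R) ≫ (A.free.map (A.toRestrict _ i).op).app _ =
      ((A.freeOn c).map (homOfLE h)).app _ := by
    rw [← NatTrans.comp_app, ← Functor.map_comp, ← op_comp, hk]
    rfl
  refine ⟨W', h, (A.free.map k.op).app _ ≫ t, hxW, ?_⟩
  rw [← hk', Category.assoc, ht]
  exact (Category.assoc _ _ _).symm

lemma isPushout_freeOn (V W : Set.Iic c.base.unop) (L : ModuleCat.{0} R) :
    IsPushout (((A.freeOn c).map (homOfLE (inf_le_left : V ⊓ W ≤ V))).app L)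
      (((A.freeOn c).map (homOfLE (inf_le_right : V ⊓ W ≤ W))).app L)
      (((A.freeOn c).map (homOfLE (le_sup_left : V ≤ V ⊔ W))).app L)
      (((A.freeOn c).map (homOfLE (le_sup_right : W ≤ V ⊔ W))).app L) := by
  let sq := A.mayerVietorisSquare c V W
  suffices h : (sq.toSquare.map (A.free.flip.obj L)).IsPushout from h
  rw [Square.isPushout_iff_op_map_yoneda_isPullback]
  intro N
  have hN : (sq.toSquare.op.map (((A.homMod L).obj N).obj.obj ⋙ forget _)).IsPullback :=
    sq.sheafCondition_of_sheaf ⟨_, (Presheaf.isSheaf_iff_isSheaf_forget A.topology _ (forget _)).1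
      ((A.homMod L).obj N).obj.property⟩
  have natural {d e : A.Site} (g : d ⟶ e) := funext fun f : (A.free.obj e).obj L ⟶ N =>
    freeHomModEquiv_free_map g f
  exact (Square.IsPullback.iff_of_equiv _ _ freeHomModEquiv freeHomModEquiv freeHomModEquiv
    freeHomModEquiv (natural _) (natural _) (natural _) (natural _)).2 hN

instance (L : ModuleCat.{0} R) [Module.Flat R L] {V W : Set.Iic c.base.unop} (h : V ⟶ W) :
    Mono ((A.freeOn c ⋙ (evaluation _ _).obj L).map h) :=
  inferInstanceAs (Mono ((A.free.map ((A.restrictions c).map h)).app L))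

lemma freeOn_hom_ext_of_eq_bot {V : Set.Iic c.base.unop} (hV : V.1 = ⊥) {L : ModuleCat.{0} R}
    {N : A.Mod} (f g : ((A.freeOn c).obj V).obj L ⟶ N) : f = g := by
  refine freeHomEquiv.injective ?_
  ext l
  exact A.eq_of_locally_eq N.obj _ _ fun x hx => ((hV ▸ hx : x ∈ (⊥ : Opens X))).elim

/-- A cocycle of degree `j` of `I` over an open subset `V` of the domain `U` of `σ`: a section of
`I(σ|_V)` killed by the differential, encoded as a morphism from `𝒜(σ|_V, ·)` extended by zero. -/
structure LocalCocycle (c : A.Total) (I : CochainComplex A.Mod ℤ) (j : ℤ) (V : Opens X) where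
  le : V ≤ c.base.unop
  hom : ((A.freeOn c).obj ⟨V, le⟩).obj (ModuleCat.of R R) ⟶ I.X j
  hom_d : hom ≫ I.d j (j + 1) = 0

/-- The restriction of a cocycle to a smaller open subset. -/
def LocalCocycle.res {I : CochainComplex A.Mod ℤ} {j : ℤ} {V W : Opens X}
    (s : LocalCocycle c I j W) (h : V ≤ W) : LocalCocycle c I j V where
  le := h.trans s.le
  hom := ((A.freeOn c).map (homOfLE h)).app _ ≫ s.hom
  hom_d := by rw [Category.assoc, s.hom_d, comp_zero]

variable (c) in
/-- The cocycles of a K-injective complex over the open subsets of `U`, up to coboundaries. -/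
def cocycleTheory (I : CochainComplex A.Mod ℤ) [I.IsKInjective] {b : ℤ}
    (hI : ∀ j, b < j → I.ExactAt j) : MayerVietorisTheory X b where
  Cls := LocalCocycle c I
  res h s := s.res h
  Null s := IsCoboundary s.hom
  null_bot {j} s := ⟨0, freeOn_hom_ext_of_eq_bot rfl _ _⟩
  null_of_le {j U V W s h} hs h' := by
    exact IsCoboundary.map_of_le (A.freeOn c ⋙ (evaluation _ _).obj (ModuleCat.of R R))
      (U := ⟨U, (h'.trans h).trans s.le⟩) (V := ⟨V, h.trans s.le⟩) (W := ⟨W, s.le⟩) hs h'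
  locally_null {j} hj W s x hx := by
    obtain ⟨V, h, t, hxV, ht⟩ := exists_lift_freeOn_of_exact
      ((HomologicalComplex.exactAt_iff' _ (j - 1) j (j + 1) (by simp) (by simp)).1 (hI j hj))
      s.hom s.hom_d hx
    exact ⟨V, h, hxV, t, ht⟩
  mayerVietoris {j W W₁ W₂} s h₁ h₂ hs₁ hs₂ := by
    obtain ⟨υ, hυ, H⟩ := exists_mayerVietoris_obstruction
      (A.freeOn c ⋙ (evaluation _ _).obj (ModuleCat.of R R))
      (fun V W => isPushout_freeOn V W _) (W := ⟨W, s.le⟩) (W₁ := ⟨W₁, h₁.trans s.le⟩)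
      (W₂ := ⟨W₂, h₂.trans s.le⟩) s.hom s.hom_d h₁ h₂ hs₁ hs₂
    exact ⟨⟨_, υ, hυ⟩, fun V₁ V₂ hV₁ hV₂ =>
      H ⟨V₁, hV₁.trans (h₁.trans s.le)⟩ ⟨V₂, hV₂.trans (h₂.trans s.le)⟩ hV₁ hV₂⟩

/-- The cocycles of `I` on `L ⊗ 𝒜(σ|_V, ·)` of degree larger than `n` become coboundaries on a
neighbourhood of a given point of `V`. This neighbourhood does not depend on the cocycle. -/
def LocallyVanishing (c : A.Total) (I : CochainComplex A.Mod ℤ) (n : ℤ) (L : ModuleCat.{0} R) :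
    Prop :=
  ∀ (V : Set.Iic c.base.unop), ∀ x ∈ V.1, ∃ (W : Set.Iic c.base.unop) (h : W ≤ V), x ∈ W.1 ∧
    ∀ j, n < j → ∀ φ : ((A.freeOn c).obj V).obj L ⟶ I.X j, φ ≫ I.d j (j + 1) = 0 →
      IsCoboundary (((A.freeOn c).map (homOfLE h)).app L ≫ φ)

variable {I : CochainComplex A.Mod ℤ}

lemma locallyVanishing_of_hasLocalDimLE {d : ℕ} (hX : HasLocalDimLE X d) [I.IsKInjective] {b : ℤ}
    (hI : ∀ j, b < j → I.ExactAt j) :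
    LocallyVanishing c I (b + d) (ModuleCat.of R R) := fun V x hx =>
  let ⟨W, h, hxW, H⟩ := hX V.1 x hx
  ⟨⟨W, h.trans V.2⟩, h, hxW, fun j hj φ hφ => H b (cocycleTheory c I hI) j ⟨V.2, φ, hφ⟩ hj⟩

lemma isCoboundary_of_finsupp {ι : Type} {d : A.Site} {j : ℤ}
    {φ : (A.free.obj d).obj (ModuleCat.of R (ι →₀ R)) ⟶ I.X j}
    (hφ : ∀ k, IsCoboundary ((A.free.obj d).map (ModuleCat.ofHom (Finsupp.lsingle k)) ≫ φ)) :
    IsCoboundary φ := by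
  choose t ht using hφ
  let t' : ModuleCat.of R (ι →₀ R) ⟶ (A.ev.obj d.unop).obj (I.X (j - 1)) :=
    ModuleCat.ofHom (Finsupp.linearCombination R fun k => freeHomEquiv (t k) (1 : R))
  have ht' (k : ι) : ModuleCat.ofHom (Finsupp.lsingle k) ≫ t' = freeHomEquiv (t k) := by
    ext
    exact (Finsupp.linearCombination_single R _ _).trans (one_smul R _)
  refine ⟨freeHomEquiv.symm t', freeHomEquiv.injective ?_⟩
  rw [freeHomEquiv_comp]
  refine ModuleCat.hom_ext (Finsupp.lhom_ext' fun k => ?_)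
  suffices h : ModuleCat.ofHom (Finsupp.lsingle k) ≫ freeHomEquiv (freeHomEquiv.symm t') ≫
      (A.ev.obj d.unop).map (I.d (j - 1) j) = ModuleCat.ofHom (Finsupp.lsingle k) ≫
        freeHomEquiv φ from ModuleCat.hom_ext_iff.1 h
  rw [Equiv.apply_symm_apply, ← freeHomEquiv_free_obj_map, ← ht, freeHomEquiv_comp, ← ht' k,
    Category.assoc]

lemma LocallyVanishing.finsupp {n : ℤ} (h : LocallyVanishing c I n (ModuleCat.of R R)) (ι : Type) :
    LocallyVanishing c I n (ModuleCat.of R (ι →₀ R)) := by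
  intro V x hx
  obtain ⟨W, h, hxW, H⟩ := h V x hx
  refine ⟨W, h, hxW, fun j hj φ hφ => isCoboundary_of_finsupp fun k => ?_⟩
  have := H j hj (((A.freeOn c).obj V).map (ModuleCat.ofHom (Finsupp.lsingle k)) ≫ φ)
    (by rw [Category.assoc, hφ, comp_zero])
  rw [← Category.assoc, ← NatTrans.naturality, Category.assoc] at this
  exact this

lemma LocallyVanishing.of_shortExact {n : ℤ} [I.IsKInjective] {S : ShortComplex (ModuleCat.{0} R)}
    (hS : S.ShortExact) [Module.Flat R S.X₃] (h₁ : LocallyVanishing c I n S.X₁)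
    (h₂ : LocallyVanishing c I n S.X₂) : LocallyVanishing c I (n + 1) S.X₃ := by
  intro V x hx
  obtain ⟨V', h, hxV', H₂⟩ := h₂ V x hx
  obtain ⟨W, h', hxW, H₁⟩ := h₁ V' x hxV'
  refine ⟨W, h'.trans h, hxW, fun j hj φ hφ => ?_⟩
  have := isCoboundary_of_shortExact (shortExact_map_free_obj ((A.restrictions c).obj W) hS)
    (S.mapNatTrans (A.free.map ((A.restrictions c).map (homOfLE h'))))
    (S.mapNatTrans (A.free.map ((A.restrictions c).map (homOfLE h))))
    (sub_add_cancel j 1) (H₂ j (by omega)) (H₁ (j - 1) (by omega)) φ hφ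
  rw [← homOfLE_comp h' h, Functor.map_comp]
  exact this

lemma exactAt_homMod {n : ℤ} {L : ModuleCat.{0} R} (hI : ∀ c, LocallyVanishing c I n L) {j : ℤ}
    (hj : n < j) :
    (((A.homMod L).mapHomologicalComplex (ComplexShape.up ℤ)).obj I).ExactAt j := by
  rw [HomologicalComplex.exactAt_iff' _ (j - 1) j (j + 1) (by simp) (by simp)]
  refine exact_of_locally_exact _ fun c s hs x hx => ?_
  change (A.ev.obj c).obj ((A.homMod L).obj (I.X j)) at s
  obtain ⟨φ, rfl⟩ := freeHomModEquiv.surjective s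
  let U : Set.Iic c.base.unop := ⟨c.base.unop, Set.mem_Iic.2 le_rfl⟩
  obtain ⟨W, h, hxW, H⟩ := hI c U x hx
  have hφ : φ ≫ I.d j (j + 1) = 0 := freeHomModEquiv.injective
    ((freeHomModEquiv_comp φ (I.d j (j + 1))).trans (hs.trans rfl))
  obtain ⟨toFree, h_toFree⟩ : ∃ p : ((A.freeOn c).obj U).obj L ⟶ (A.free.obj (op c)).obj L,
      ((A.freeOn c).map (homOfLE h)).app L ≫ p =
        (A.free.map (A.toRestrict c (homOfLE W.2)).op).app L := by
    refine ⟨(A.free.map (A.toRestrict c (𝟙 c.base.unop)).op).app L, ?_⟩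
    rw [← toRestrict_resHom le_rfl h, op_comp, Functor.map_comp]
    rfl
  obtain ⟨θ, hθ⟩ := H j hj (toFree ≫ φ) (by rw [Category.assoc, hφ, comp_zero])
  rw [← Category.assoc, h_toFree] at hθ
  refine ⟨W.1, homOfLE W.2, freeHomModEquiv θ, hxW, ?_⟩
  exact (freeHomModEquiv_comp θ _).symm.trans
    ((congrArg freeHomModEquiv hθ).trans (freeHomModEquiv_free_map _ φ))

lemma locallyVanishing_of_isLocalization [I.IsKInjective] {n : ℤ}
    (hI : LocallyVanishing c I n (ModuleCat.of R R)) (r : R) (L : Type)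
    [CommRing L] [Algebra R L] [IsLocalization.Away r L] :
    LocallyVanishing c I (n + 1) (ModuleCat.of R L) :=
  have : Module.Flat R (telescopeComplex r L).X₃ := IsLocalization.flat L (Submonoid.powers r)
  .of_shortExact (shortExact_telescopeComplex r L) (hI.finsupp ℕ) (hI.finsupp ℕ)

lemma isLE_homMod {d : ℕ} (hX : HasLocalDimLE X d) (r : R) (L : Type) [CommRing L] [Algebra R L]
    [IsLocalization.Away r L] (I : CochainComplex A.Mod ℤ) [I.IsKInjective] {b : ℤ} [I.IsLE b] :
    CochainComplex.IsLE (((A.homMod (ModuleCat.of R L)).mapHomologicalComplex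
      (ComplexShape.up ℤ)).obj I) (b + d + 1) := by
  rw [CochainComplex.isLE_iff]
  exact fun j hj => exactAt_homMod (fun c => locallyVanishing_of_isLocalization
    (locallyVanishing_of_hasLocalDimLE hX fun j hj => I.exactAt_of_isLE b j hj) r L) hj

end Algebroid

end DQ

end

theorem corollary4p4_general {R : Type} [CommRing R] {X : TopCat.{0}} {d : ℕ}
    (hX : DQ.HasLocalDimLE X d) (A : DQ.Algebroid R X) (r : R) (L : Type) [CommRing L] [Algebra R L]
    [IsLocalization.Away r L] [HasDerivedCategory.{w} A.Mod] (M N : DerivedCategory A.Mod)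
    (hM : DerivedCategory.TStructure.t.minus M) (hN : A.IsRHom (ModuleCat.of R L) M N) :
    DerivedCategory.TStructure.t.minus N := by
  obtain ⟨b, hb⟩ := hM
  obtain ⟨I, hI, ⟨e⟩, ⟨e'⟩⟩ := hN
  have hIb : I.IsLE b := (DerivedCategory.isLE_Q_obj_iff _ _).1
    ⟨(DerivedCategory.TStructure.t.le b).prop_of_iso e.symm hb.le⟩
  have hle := DQ.Algebroid.isLE_homMod hX r L I (b := b)
  exact ⟨b + d + 1, ⟨(DerivedCategory.TStructure.t.le _).prop_of_iso e'
    ((DerivedCategory.isLE_Q_obj_iff _ _).2 hle).le⟩⟩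

/-- Let `X` be a smooth complex (algebraic or analytic) variety with a DQ-algebroid `𝒜_X`. The functor
`Rℋom_{𝒜_X}(𝒜_X^loc, ·)` sends `D⁻(𝒜_X)` into `D⁻(𝒜_X)`. -/
theorem corollary4p4 (X : DQ.SmoothComplexVariety) (A : DQ.DQAlgebroid X)
    [HasDerivedCategory.{w} A.Mod] (M N : DerivedCategory A.Mod)
    (hM : DerivedCategory.TStructure.t.minus M) (hN : A.IsRHomLoc M N) :
    DerivedCategory.TStructure.t.minus N := by
  obtain ⟨d, hX⟩ := X.exists_hasLocalDimLE
  exact corollary4p4_general hX A.toAlgebroid PowerSeries.X ℂ⸨X⸩ M N hM hN
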